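/- **Setting.** Consider a call-by-value, simply typed $\lambda$-calculus with base types $\mathsf{bool},\mathsf{int},\mathsf{unit}$ (with constants and typed, possibly partial, operations on them), $n$-ary tuples, recursive functions $\lambda^f x.e$ annotated with their types, local references holding arbitrary values (locations are not values), and abstract function names $\alpha_{T\to T'}$. A *configuration* is either the special $\bot$ or a tuple $\langle A;\Gamma;K;s;\hat e\rangle$, where $A$ is a set of abstract names, $\Gamma$ a finite partial map from indices $i\in\mathbb N$ to values, $K$ a stack of evaluation contexts with typed hole, $s$ a store, and $\hat e$ an expression or "$\cdot$" (none). It is *well-formed* when $A$ is finite, contains all its abstract names, and all components are closed and well typed with respect to the typing of $s$. An *ultimate pattern* of a value $v$ is a pair $(D,\Gamma')$ where $D$ is $v$ with each function replaced by a hole with a distinct index and $\Gamma'$ maps exactly these indices to the replaced functions. The transitions are: * $\langle A;\Gamma;K;s;E[\alpha\,v]\rangle\xrightarrow{\mathsf{papp}(\alpha,D)}\langle A;\Gamma,\Gamma';E,K;s;\cdot\rangle$ and $\langle A;\Gamma;K;s;v\rangle\xrightarrow{\mathsf{pret}(D)}\langle A;\Gamma,\Gamma';K;s;\cdot\rangle$,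 for $(D,\Gamma')$ an ultimate pattern of $v$ with $\mathrm{dom}\,\Gamma'\cap\mathrm{dom}\,\Gamma=\emptyset$; * $\langle A;\Gamma;K;s;\cdot\rangle\xrightarrow{\mathsf{oapp}(i,u)}\langle A\uplus\vec\alpha;\Gamma;K;s;e\rangle$, for $\Gamma(i)$ of type $T\to T'$, where $e=\alpha\,u$ if $\Gamma(i)=\alpha$ and $e$ is the $\beta$-reduct of $\Gamma(i)\,u$ if $\Gamma(i)$ is a $\lambda$-abstraction; and $\langle A;\Gamma;E[\cdot]_T,K;s;\cdot\rangle\xrightarrow{\mathsf{oret}(u)}\langle A\uplus\vec\alpha;\Gamma;K;s;E[u]\rangle$; here $u$ is a value of type $T$ built from constants, tuples and pairwise distinct abstract names $\vec\alpha\notin A$; * $\langle A;\Gamma;K;s;e\rangle\xrightarrow{\tau}\langle A;\Gamma;K;s';e'\rangle$ if $(s,e)$ reduces to $(s',e')$; * $C\xrightarrow{\eta}\bot$ for every configuration $C$ and label $\eta\neq\mathsf{term}$; and $\langle A;\Gamma;\varepsilon;s;\cdot\rangle\xrightarrow{\mathsf{term}}\bot$. Let $\stackrel{\tau}{\Rightarrow}$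 be $\xrightarrow{\tau}{}^*$ and, for $\eta\ne\tau$, $\stackrel{\eta}{\Rightarrow}$ be $\xrightarrow{\tau}{}^*\xrightarrow{\eta}\xrightarrow{\tau}{}^*$. For a relation $R$ on configurations, let $\mathrm{WP}(R)$ relate $C_1$ to $C_2$ when for all $C_1\xrightarrow{\eta}C_1'$ there is $C_2'$ with $C_2\stackrel{\eta}{\Rightarrow}C_2'$ and $C_1'\,R\,C_2'$. $R$ is a *weak simulation* if $R\subseteq \mathrm{WP}(R)$ and a *weak simulation up to $f$* if $R\subseteq \mathrm{WP}(f(R))$; *similarity* $\precsim$ is the largest weak simulation. A function $f$ on relations is a *sound up-to technique* if every weak simulation up to $f$ is contained in $\precsim$. The *companion* $t$ is the pointwise union of all monotone $f$ with $f(\mathrm{WP}(R))\subseteq \mathrm{WP}(f(R))$ for all $R$. Write $f\sqsubseteq g$ for pointwise inclusion, and $f^\omega=\bigsqcup_{n<\omega}f^n$. **Separation.** For well-formed $C_j=\langle A_j;\Gamma_j;K_j;s_j;\hat e_j\rangle$ ($j=1,2$) with $\mathrm{dom}\,\Gamma_1\cap\mathrm{dom}\,\Gamma_2=\emptyset$ and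 $\mathrm{dom}\,s_1\cap\mathrm{dom}\,s_2=\emptyset$, for $i\in\{1,2\}$ such that $\hat e_{3-i}=\cdot$, and for a sequence $\vec k$ over $\{1,2\}$ with $|K_1|$ ones and $|K_2|$ twos, let $$C_1\ast^i_{\vec k}C_2=\langle A_1\cup A_2;\Gamma_1,\Gamma_2;K_1\parallel_{\vec k}K_2;s_1,s_2;\hat e_i\rangle,$$ where $K_1\parallel_{\vec k}K_2$ interleaves the stacks, taking the next frame from $K_1$ or $K_2$ as told by $\vec k$. The *up-to-separation* function $\mathsf{sep}$ sends $R$ to the relation consisting of * $(C_1\ast^i_{\vec k}C_3,\;C_2\ast^i_{\vec k}C_4)$, whenever $C_1\,R\,C_2$, $C_3\,R\,C_4$, both conjunctions are defined, the environments of $C_1,C_2$ have the same domain, those of $C_3,C_4$ have the same domain, and the name sets satisfy $A_2\subseteq A_1$ and $A_4\subseteq A_3$; * $(C_1\ast^i_{\vec k}C_3,\;\bot)$, whenever the conjunction is defined and either $C_1\,R\,\bot$ and $C_3\,R\,C_4$ for some $C_4$, or $C_1\,R\,C_2$ for some $C_2$ and $C_3\,R\,\bot$. **Lemma (soundness of up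 to separation).** The function $\mathsf{sep}$ is monotone and is a sound up-to technique: every weak simulation up to $\mathsf{sep}$ is contained in $\precsim$. Moreover, $R\mapsto R\cup\mathsf{sep}(R)$ is a sound up-to technique; $\mathsf{sep}\sqsubseteq t$; and for every $g\sqsubseteq t$ the function $(\mathsf{sep}\sqcup g)^\omega$ is a sound up-to technique. -/

import Mathlib

namespace SepUpTo

/-! ### Types, constants, operations -/

/-- Base types. -/
inductive Base : Type
  | bool
  | int
  | unit

/-- Types: base types, function types, and products of arbitrary length. -/
inductive Ty : Type
  | base (b : Base)
  | arr (T T' : Ty)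
  | prod (Ts : List Ty)

/-- Constants of base type. -/
inductive Const : Type
  | bool (b : Bool)
  | int (n : ℤ)
  | unit

/-- The type of a constant. -/
def Const.ty : Const → Base
  | .bool _ => .bool
  | .int _ => .int
  | .unit => .unit

/-- The arithmetic operations of the language: each has an arity (argument and result base types)
and a possibly partial interpretation on constants, which respects its arity. -/
structure OpSig where
  Op : Type
  args : Op → List Base
  res : Op → Base
  eval : Op → List Const → Option Const
  eval_ty : ∀ o cs c, cs.map Const.ty = args o → eval o cs = some c → c.ty = res o

/-- Abstract function names, annotated with the function type they represent. There are infinitely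
many names of each function type. -/
structure Name : Type where
  id : ℕ
  dom : Ty
  cod : Ty

/-- An occurrence of a location: a free (i.e. global) location, or a de Bruijn index
referring to an enclosing location binder. -/
inductive LRef : Type
  | free (l : ℕ)
  | bound (k : ℕ)

/-! ### Expressions -/

/-- Expressions, up to renaming of bound variables and bound locations (de Bruijn indices).
* `lam T T' e` is the recursive function `λ^f x. e` of type `T → T'`;
  in `e`, index `0` is the argument `x` and index `1` is the function `f` itself.
* `new v e` is `new l v e`; it binds a location in `e`.
* `letIn n e e'` is `let (x₁,…,xₙ) = e in e'`; in `e'`, the indices `0,…,n-1` are `x₁,…,xₙ`. -/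
inductive Exp (O : OpSig) : Type
  | const (c : Const)
  | var (n : ℕ)
  | lam (T T' : Ty) (e : Exp O)
  | name (a : Name)
  | tuple (es : List (Exp O))
  | op (o : O.Op) (es : List (Exp O))
  | app (e e' : Exp O)
  | ite (e e₁ e₂ : Exp O)
  | new (v e : Exp O)
  | deref (l : LRef)
  | assign (l : LRef) (e : Exp O)
  | letIn (n : ℕ) (e e' : Exp O)

variable {O : OpSig}

/-- Values: constants, variables, functions, abstract names, and tuples of values. -/
inductive IsVal : Exp O → Prop
  | const (c : Const) : IsVal (.const c)
  | var (n : ℕ) : IsVal (.var n)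
  | lam (T T' : Ty) (e : Exp O) : IsVal (.lam T T' e)
  | name (a : Name) : IsVal (.name a)
  | tuple (es : List (Exp O)) (h : ∀ e ∈ es, IsVal e) : IsVal (.tuple es)

/-- `v` is a function value of (annotated) type `T → T'`. -/
inductive IsFun : Exp O → Ty → Ty → Prop
  | lam (T T' : Ty) (e : Exp O) : IsFun (.lam T T' e) T T'
  | name (a : Name) : IsFun (.name a) a.dom a.cod

mutual
/-- `e.inst k vs` substitutes the values `vs` for the variables `k, k+1, …, k + vs.length - 1`.
Reduction only ever substitutes closed values, so that these need no shifting under binders. -/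
def Exp.inst (k : ℕ) (vs : List (Exp O)) : Exp O → Exp O
  | .const c => .const c
  | .var n => if n < k then .var n else (vs[n - k]?).getD (.var (n - vs.length))
  | .lam T T' e => .lam T T' (e.inst (k + 2) vs)
  | .name a => .name a
  | .tuple es => .tuple (Exp.insts k vs es)
  | .op o es => .op o (Exp.insts k vs es)
  | .app e e' => .app (e.inst k vs) (e'.inst k vs)
  | .ite e e₁ e₂ => .ite (e.inst k vs) (e₁.inst k vs) (e₂.inst k vs)
  | .new v e => .new (v.inst k vs) (e.inst k vs)
  | .deref l => .deref l
  | .assign l e => .assign l (e.inst k vs)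
  | .letIn n e e' => .letIn n (e.inst k vs) (e'.inst (k + n) vs)
/-- `Exp.inst` on lists of expressions. -/
def Exp.insts (k : ℕ) (vs : List (Exp O)) : List (Exp O) → List (Exp O)
  | [] => []
  | e :: es => e.inst k vs :: Exp.insts k vs es
end

/-- Replace the bound location `k` by the free location `l`. -/
def LRef.openAt (k l : ℕ) : LRef → LRef
  | .free l' => .free l'
  | .bound j => if j = k then .free l else .bound j

mutual
/-- Replace the bound location `k` by the free location `l` in an expression. -/
def Exp.openLoc (k l : ℕ) : Exp O → Exp O
  | .const c => .const c
  | .var n => .var n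
  | .lam T T' e => .lam T T' (e.openLoc k l)
  | .name a => .name a
  | .tuple es => .tuple (Exp.openLocs k l es)
  | .op o es => .op o (Exp.openLocs k l es)
  | .app e e' => .app (e.openLoc k l) (e'.openLoc k l)
  | .ite e e₁ e₂ => .ite (e.openLoc k l) (e₁.openLoc k l) (e₂.openLoc k l)
  | .new v e => .new (v.openLoc k l) (e.openLoc (k + 1) l)
  | .deref r => .deref (r.openAt k l)
  | .assign r e => .assign (r.openAt k l) (e.openLoc k l)
  | .letIn n e e' => .letIn n (e.openLoc k l) (e'.openLoc k l)
/-- `Exp.openLoc` on lists of expressions. -/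
def Exp.openLocs (k l : ℕ) : List (Exp O) → List (Exp O)
  | [] => []
  | e :: es => e.openLoc k l :: Exp.openLocs k l es
end

mutual
/-- The set of abstract names of an expression. -/
def Exp.names : Exp O → Set Name
  | .const _ => ∅
  | .var _ => ∅
  | .lam _ _ e => e.names
  | .name a => {a}
  | .tuple es => Exp.namess es
  | .op _ es => Exp.namess es
  | .app e e' => e.names ∪ e'.names
  | .ite e e₁ e₂ => e.names ∪ e₁.names ∪ e₂.names
  | .new v e => v.names ∪ e.names
  | .deref _ => ∅
  | .assign _ e => e.names
  | .letIn _ e e' => e.names ∪ e'.names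
/-- The set of abstract names of a list of expressions. -/
def Exp.namess : List (Exp O) → Set Name
  | [] => ∅
  | e :: es => e.names ∪ Exp.namess es
end

/-! ### Typing -/

/-- The type of a location occurrence, for `S` the typing of free locations and `L` the types of
the bound ones. -/
def LRef.ty (S : ℕ → Option Ty) (L : List Ty) : LRef → Option Ty
  | .free l => S l
  | .bound k => L[k]?

/-- Typing judgements `Δ; S ⊢ e : T`; the list `L` holds the types of the bound locations in
scope. -/
inductive HasTy (S : ℕ → Option Ty) : List Ty → List Ty → Exp O → Ty → Prop
  | const {Δ L} (c : Const) : HasTy S Δ L (.const c) (.base c.ty)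
  | var {Δ L} (n : ℕ) (T : Ty) (h : Δ[n]? = some T) : HasTy S Δ L (.var n) T
  | lam {Δ L} (T T' : Ty) (e : Exp O) (h : HasTy S (T :: .arr T T' :: Δ) L e T') :
      HasTy S Δ L (.lam T T' e) (.arr T T')
  | name {Δ L} (a : Name) : HasTy S Δ L (.name a) (.arr a.dom a.cod)
  | tuple {Δ L} (es : List (Exp O)) (Ts : List Ty) (hlen : es.length = Ts.length)
      (h : ∀ p ∈ es.zip Ts, HasTy S Δ L p.1 p.2) : HasTy S Δ L (.tuple es) (.prod Ts)
  | op {Δ L} (o : O.Op) (es : List (Exp O)) (hlen : es.length = (O.args o).length)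
      (h : ∀ p ∈ es.zip (O.args o), HasTy S Δ L p.1 (.base p.2)) :
      HasTy S Δ L (.op o es) (.base (O.res o))
  | app {Δ L} (e e' : Exp O) (T T' : Ty) (h : HasTy S Δ L e (.arr T T')) (h' : HasTy S Δ L e' T) :
      HasTy S Δ L (.app e e') T'
  | ite {Δ L} (e e₁ e₂ : Exp O) (T : Ty) (h : HasTy S Δ L e (.base .bool))
      (h₁ : HasTy S Δ L e₁ T) (h₂ : HasTy S Δ L e₂ T) : HasTy S Δ L (.ite e e₁ e₂) T
  | new {Δ L} (v e : Exp O) (T T' : Ty) (hv : IsVal v) (h : HasTy S Δ L v T)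
      (h' : HasTy S Δ (T :: L) e T') : HasTy S Δ L (.new v e) T'
  | deref {Δ L} (l : LRef) (T : Ty) (h : l.ty S L = some T) : HasTy S Δ L (.deref l) T
  | assign {Δ L} (l : LRef) (e : Exp O) (T : Ty) (h : l.ty S L = some T) (h' : HasTy S Δ L e T) :
      HasTy S Δ L (.assign l e) (.base .unit)
  | letIn {Δ L} (Ts : List Ty) (e e' : Exp O) (T : Ty) (h : HasTy S Δ L e (.prod Ts))
      (h' : HasTy S (Ts ++ Δ) L e' T) : HasTy S Δ L (.letIn Ts.length e e') T

/-! ### Evaluation contexts and reduction -/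

/-- Evaluation contexts (see `ECtx.Valid` for the requirement that the components on the left of
the hole are values). -/
inductive ECtx (O : OpSig) : Type
  | hole
  | tuple (vs : List (Exp O)) (E : ECtx O) (es : List (Exp O))
  | op (o : O.Op) (vs : List (Exp O)) (E : ECtx O) (es : List (Exp O))
  | appL (E : ECtx O) (e : Exp O)
  | appR (v : Exp O) (E : ECtx O)
  | assign (l : LRef) (E : ECtx O)
  | ite (E : ECtx O) (e₁ e₂ : Exp O)
  | letIn (n : ℕ) (E : ECtx O) (e : Exp O)

/-- `E.fill e` is `E[e]`. -/
def ECtx.fill : ECtx O → Exp O → Exp O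
  | .hole, e => e
  | .tuple vs E es, e => .tuple (vs ++ E.fill e :: es)
  | .op o vs E es, e => .op o (vs ++ E.fill e :: es)
  | .appL E e', e => .app (E.fill e) e'
  | .appR v E, e => .app v (E.fill e)
  | .assign l E, e => .assign l (E.fill e)
  | .ite E e₁ e₂, e => .ite (E.fill e) e₁ e₂
  | .letIn n E e', e => .letIn n (E.fill e) e'

/-- The components to the left of the hole are values. -/
def ECtx.Valid : ECtx O → Prop
  | .hole => True
  | .tuple vs E _ => (∀ v ∈ vs, IsVal v) ∧ E.Valid
  | .op _ vs E _ => (∀ v ∈ vs, IsVal v) ∧ E.Valid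
  | .appL E _ => E.Valid
  | .appR v E => IsVal v ∧ E.Valid
  | .assign _ E => E.Valid
  | .ite E _ _ => E.Valid
  | .letIn _ E _ => E.Valid

/-- The abstract names of an evaluation context. -/
def ECtx.names (E : ECtx O) : Set Name := (E.fill (.const .unit)).names

/-- Stores: finite partial maps from locations to values. -/
abbrev Store (O : OpSig) := Finmap (fun _ : ℕ => Exp O)

/-- Knowledge environments: finite partial maps from indices to values. -/
abbrev Env (O : OpSig) := Finmap (fun _ : ℕ => Exp O)

/-- Base reduction. -/
inductive RedBase : Store O → Exp O → Store O → Exp O → Prop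
  | op (s : Store O) (o : O.Op) (cs : List Const) (w : Const) (h : O.eval o cs = some w) :
      RedBase s (.op o (cs.map Exp.const)) s (.const w)
  | beta (s : Store O) (T T' : Ty) (e v : Exp O) (hv : IsVal v) :
      RedBase s (.app (.lam T T' e) v) s (e.inst 0 [v, .lam T T' e])
  | letIn (s : Store O) (vs : List (Exp O)) (e : Exp O) (hv : ∀ v ∈ vs, IsVal v) :
      RedBase s (.letIn vs.length (.tuple vs) e) s (e.inst 0 vs)
  | new (s : Store O) (l : ℕ) (v e : Exp O) (hv : IsVal v) (hl : l ∉ s) :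
      RedBase s (.new v e) (s.insert l v) (e.openLoc 0 l)
  | deref (s : Store O) (l : ℕ) (v : Exp O) (h : s.lookup l = some v) :
      RedBase s (.deref (.free l)) s v
  | assign (s : Store O) (l : ℕ) (v : Exp O) (hv : IsVal v) :
      RedBase s (.assign (.free l) v) (s.insert l v) (.const .unit)
  | iteTrue (s : Store O) (e₁ e₂ : Exp O) : RedBase s (.ite (.const (.bool true)) e₁ e₂) s e₁
  | iteFalse (s : Store O) (e₁ e₂ : Exp O) : RedBase s (.ite (.const (.bool false)) e₁ e₂) s e₂

/-- Small-step reduction, in an evaluation context. -/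
inductive Red : Store O → Exp O → Store O → Exp O → Prop
  | ctx (E : ECtx O) (hE : E.Valid) (s s' : Store O) (e e' : Exp O) (h : RedBase s e s' e') :
      Red s (E.fill e) s' (E.fill e')

/-! ### Ultimate patterns -/

/-- Function-free contexts built from constants, tuples and indexed holes `[·]_{i, T → T'}` that
stand for functions. -/
inductive Pat : Type
  | const (c : Const)
  | tuple (Ds : List Pat)
  | hole (i : ℕ) (T T' : Ty)

mutual
/-- The holes of a pattern, from left to right. -/
def Pat.holes : Pat → List (ℕ × Ty × Ty)
  | .const _ => []
  | .tuple Ds => Pat.holess Ds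
  | .hole i T T' => [(i, T, T')]
/-- The holes of a list of patterns. -/
def Pat.holess : List Pat → List (ℕ × Ty × Ty)
  | [] => []
  | D :: Ds => D.holes ++ Pat.holess Ds
end

mutual
/-- `D.fill Γ` is `D[Γ]`; it is only used when the holes of `D` have their indices in the domain
of `Γ`. -/
def Pat.fill (Γ : Env O) : Pat → Exp O
  | .const c => .const c
  | .tuple Ds => .tuple (Pat.fills Γ Ds)
  | .hole i _ _ => (Γ.lookup i).getD (.const .unit)
/-- `Pat.fill` on lists of patterns. -/
def Pat.fills (Γ : Env O) : List Pat → List (Exp O)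
  | [] => []
  | D :: Ds => D.fill Γ :: Pat.fills Γ Ds
end

/-- `(D, Γ)` is an ultimate pattern of the value `v`: the holes of `D` have distinct indices, these
are the domain of `Γ`, each is mapped to a function of the type of the hole, and `D[Γ] = v`. -/
structure UltPat (v : Exp O) (D : Pat) (Γ : Env O) : Prop where
  nodup : (D.holes.map Prod.fst).Nodup
  dom : ∀ i, i ∈ Γ ↔ i ∈ D.holes.map Prod.fst
  isFun : ∀ i T T', (i, T, T') ∈ D.holes → ∃ w, Γ.lookup i = some w ∧ IsFun w T T'
  fill : D.fill Γ = v

/-- Ultimate patterns of a type: `u = D[α⃗]` has type `T`, where `D` contains no functions and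
`α⃗` is a sequence of distinct abstract names, one for each hole of `D`. -/
def OppVal (T : Ty) (u : Exp O) : Prop :=
  ∃ (D : Pat) (as : Env O), UltPat u D as ∧
    (∀ i w, as.lookup i = some w → ∃ a, w = .name a) ∧
    (∀ i j w, as.lookup i = some w → as.lookup j = some w → i = j) ∧
    HasTy (fun _ => none) [] [] u T

/-! ### Configurations and their transitions -/

/-- A proponent continuation `E[·]_T`, with the type of its hole. -/
structure Frame (O : OpSig) where
  holeTy : Ty
  ctx : ECtx O

/-- Configurations `⟨A; Γ; K; s; ê⟩`, where `ê = none` in opponent configurations, and the special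
configuration `⊥`. -/
inductive Conf (O : OpSig) : Type
  | bot
  | mk (A : Set Name) (Γ : Env O) (K : List (Frame O)) (s : Store O) (e : Option (Exp O))

/-- `S` is the typing of the store `s`. -/
structure StoreTyping (s : Store O) (S : ℕ → Option Ty) : Prop where
  dom : ∀ l, (∃ T, S l = some T) ↔ l ∈ s
  typed : ∀ l v T, s.lookup l = some v → S l = some T → IsVal v ∧ HasTy S [] [] v T

/-- Well-formed configurations: the set `A` is finite and contains all abstract names of the
configuration, and all components are closed and well typed with respect to the typing of the
store (hence all their locations are in the domain of the store). -/
def WellFormed (A : Set Name) (Γ : Env O) (K : List (Frame O)) (s : Store O)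
    (e : Option (Exp O)) : Prop :=
  A.Finite ∧
  (∀ i v, Γ.lookup i = some v → v.names ⊆ A) ∧
  (∀ F ∈ K, F.ctx.names ⊆ A) ∧
  (∀ l v, s.lookup l = some v → v.names ⊆ A) ∧
  (∀ e₀, e = some e₀ → e₀.names ⊆ A) ∧
  ∃ S : ℕ → Option Ty, StoreTyping s S ∧
    (∀ i v, Γ.lookup i = some v → IsVal v ∧ ∃ T, HasTy S [] [] v T) ∧
    (∀ F ∈ K, F.ctx.Valid ∧ ∃ T', ∀ e₀, HasTy S [] [] e₀ F.holeTy →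
      HasTy S [] [] (F.ctx.fill e₀) T') ∧
    (∀ e₀, e = some e₀ → ∃ T, HasTy S [] [] e₀ T)

/-- Transition labels: proponent application and return, opponent application and return, internal
step, and termination. -/
inductive Label (O : OpSig) : Type
  | papp (a : Name) (D : Pat)
  | pret (D : Pat)
  | oapp (i : ℕ) (u : Exp O)
  | oret (u : Exp O)
  | tau
  | term

/-- The first step of the application of a function value `v` to `u` by the opponent. -/
inductive FunRed : Exp O → Exp O → Exp O → Prop
  | name (a : Name) (u : Exp O) : FunRed (.name a) u (.app (.name a) u)
  | lam (T T' : Ty) (e u : Exp O) : FunRed (.lam T T' e) u (e.inst 0 [u, .lam T T' e])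

/-- The labelled transition system. -/
inductive Trans : Conf O → Label O → Conf O → Prop
  | propApp (A : Set Name) (Γ Γ' : Env O) (K : List (Frame O)) (s : Store O) (E : ECtx O)
      (a : Name) (v : Exp O) (D : Pat) (hE : E.Valid) (hv : IsVal v) (hD : UltPat v D Γ')
      (hΓ : Γ.Disjoint Γ') :
      Trans (.mk A Γ K s (some (E.fill (.app (.name a) v)))) (.papp a D)
        (.mk A (Γ ∪ Γ') (⟨a.cod, E⟩ :: K) s none)
  | propRet (A : Set Name) (Γ Γ' : Env O) (K : List (Frame O)) (s : Store O)
      (v : Exp O) (D : Pat) (hv : IsVal v) (hD : UltPat v D Γ') (hΓ : Γ.Disjoint Γ') :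
      Trans (.mk A Γ K s (some v)) (.pret D) (.mk A (Γ ∪ Γ') K s none)
  | opApp (A : Set Name) (Γ : Env O) (K : List (Frame O)) (s : Store O) (S : ℕ → Option Ty)
      (i : ℕ) (v u e : Exp O) (T T' : Ty) (hi : Γ.lookup i = some v) (hS : StoreTyping s S)
      (hT : HasTy S [] [] v (.arr T T')) (hu : OppVal T u) (hA : Disjoint A u.names)
      (he : FunRed v u e) :
      Trans (.mk A Γ K s none) (.oapp i u) (.mk (A ∪ u.names) Γ K s (some e))
  | opRet (A : Set Name) (Γ : Env O) (K : List (Frame O)) (s : Store O) (T : Ty) (E : ECtx O)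
      (u : Exp O) (hu : OppVal T u) (hA : Disjoint A u.names) :
      Trans (.mk A Γ (⟨T, E⟩ :: K) s none) (.oret u) (.mk (A ∪ u.names) Γ K s (some (E.fill u)))
  | tau (A : Set Name) (Γ : Env O) (K : List (Frame O)) (s s' : Store O) (e e' : Exp O)
      (h : Red s e s' e') :
      Trans (.mk A Γ K s (some e)) .tau (.mk A Γ K s' (some e'))
  | response (C : Conf O) (η : Label O) (h : η ≠ .term) : Trans C η .bot
  | term (A : Set Name) (Γ : Env O) (s : Store O) : Trans (.mk A Γ [] s none) .term .bot

/-- `τ`-transitions, any number of them. -/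
def TauStar : Conf O → Conf O → Prop :=
  Relation.ReflTransGen (fun C C' => Trans C .tau C')

/-- Weak transitions. -/
def WTrans (C : Conf O) (η : Label O) (C' : Conf O) : Prop :=
  (η = .tau ∧ TauStar C C') ∨
  (η ≠ .tau ∧ ∃ C₁ C₂, TauStar C C₁ ∧ Trans C₁ η C₂ ∧ TauStar C₂ C')

/-! ### Simulations and up-to techniques -/

/-- Binary relations on configurations (a complete lattice, ordered by inclusion). -/
abbrev CRel (O : OpSig) := Conf O → Conf O → Prop

/-- Weak progression: the relation `WP R`. -/
def WP (R : CRel O) : CRel O := fun C₁ C₂ =>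
  ∀ η C₁', Trans C₁ η C₁' → ∃ C₂', WTrans C₂ η C₂' ∧ R C₁' C₂'

/-- `R` is a weak simulation. -/
def IsWeakSim (R : CRel O) : Prop := R ≤ WP R

/-- Similarity: the largest weak simulation. -/
def Similarity : CRel O := fun C₁ C₂ => ∃ R : CRel O, IsWeakSim R ∧ R C₁ C₂

/-- `R` is a weak simulation up to `f`. -/
def IsWeakSimUpTo (f : CRel O → CRel O) (R : CRel O) : Prop := R ≤ WP (f R)

/-- Sound up-to techniques. -/
def IsSoundUpTo (f : CRel O → CRel O) : Prop :=
  ∀ R : CRel O, IsWeakSimUpTo f R → R ≤ Similarity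

/-- Compatible functions: monotone `f` with `f ∘ WP ⊑ WP ∘ f`. -/
def IsCompatible (f : CRel O → CRel O) : Prop :=
  Monotone f ∧ ∀ R : CRel O, f (WP R) ≤ WP (f R)

/-- The companion: the pointwise union of all compatible functions. -/
def companion : CRel O → CRel O := fun R C₁ C₂ => ∃ f, IsCompatible f ∧ f R C₁ C₂

/-- `f^ω`, the pointwise union of the iterates `f^n`, for `n < ω`. -/
def omegaIter (f : CRel O → CRel O) : CRel O → CRel O := fun R C₁ C₂ => ∃ n : ℕ, (f^[n]) R C₁ C₂

/-! ### Separating conjunction and up to separation -/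

/-- The two components of a separating conjunction. -/
inductive Side : Type
  | one
  | two

/-- `Interleave k K₁ K₂ K` states that `K` is the interleaving of `K₁` and `K₂` along `k`. -/
inductive Interleave : List Side → List (Frame O) → List (Frame O) → List (Frame O) → Prop
  | nil : Interleave [] [] [] []
  | one (k : List Side) (E : Frame O) (K₁ K₂ K : List (Frame O)) (h : Interleave k K₁ K₂ K) :
      Interleave (.one :: k) (E :: K₁) K₂ (E :: K)
  | two (k : List Side) (E : Frame O) (K₁ K₂ K : List (Frame O)) (h : Interleave k K₁ K₂ K) :
      Interleave (.two :: k) K₁ (E :: K₂) (E :: K)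

/-- `SepConj i k C₁ C₂ C` states that the separating conjunction of `C₁` and `C₂`, along `k` and
with the expression of component `i`, is defined and equal to `C`. -/
inductive SepConj : Side → List Side → Conf O → Conf O → Conf O → Prop
  | one (k : List Side) (A₁ A₂ : Set Name) (Γ₁ Γ₂ : Env O) (K₁ K₂ K : List (Frame O))
      (s₁ s₂ : Store O) (e : Option (Exp O))
      (h₁ : WellFormed A₁ Γ₁ K₁ s₁ e) (h₂ : WellFormed A₂ Γ₂ K₂ s₂ none)
      (hΓ : Γ₁.Disjoint Γ₂) (hK : Interleave k K₁ K₂ K) (hs : s₁.Disjoint s₂) :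
      SepConj .one k (.mk A₁ Γ₁ K₁ s₁ e) (.mk A₂ Γ₂ K₂ s₂ none)
        (.mk (A₁ ∪ A₂) (Γ₁ ∪ Γ₂) K (s₁ ∪ s₂) e)
  | two (k : List Side) (A₁ A₂ : Set Name) (Γ₁ Γ₂ : Env O) (K₁ K₂ K : List (Frame O))
      (s₁ s₂ : Store O) (e : Option (Exp O))
      (h₁ : WellFormed A₁ Γ₁ K₁ s₁ none) (h₂ : WellFormed A₂ Γ₂ K₂ s₂ e)
      (hΓ : Γ₁.Disjoint Γ₂) (hK : Interleave k K₁ K₂ K) (hs : s₁.Disjoint s₂) :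
      SepConj .two k (.mk A₁ Γ₁ K₁ s₁ none) (.mk A₂ Γ₂ K₂ s₂ e)
        (.mk (A₁ ∪ A₂) (Γ₁ ∪ Γ₂) K (s₁ ∪ s₂) e)

/-- The abstract names recorded in a configuration. -/
def Conf.used : Conf O → Set Name
  | .bot => ∅
  | .mk A _ _ _ _ => A

/-- The domain of the environment of a configuration. -/
def Conf.envDom : Conf O → Finset ℕ
  | .bot => ∅
  | .mk _ Γ _ _ _ => Γ.keys

/-- The up-to-separation function. -/
inductive utSep (R : CRel O) : CRel O
  | sep (i : Side) (k : List Side) (C₁ C₂ C₃ C₄ C C' : Conf O) (h₁ : R C₁ C₂) (h₂ : R C₃ C₄)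
      (hd₁ : C₁.envDom = C₂.envDom) (hd₂ : C₃.envDom = C₄.envDom)
      (hA₁ : C₂.used ⊆ C₁.used) (hA₂ : C₄.used ⊆ C₃.used)
      (hC : SepConj i k C₁ C₃ C) (hC' : SepConj i k C₂ C₄ C') : utSep R C C'
  | botL (i : Side) (k : List Side) (C₁ C₃ C₄ C : Conf O) (h₁ : R C₁ .bot) (h₂ : R C₃ C₄)
      (hC : SepConj i k C₁ C₃ C) : utSep R C .bot
  | botR (i : Side) (k : List Side) (C₁ C₂ C₃ C : Conf O) (h₁ : R C₁ C₂) (h₂ : R C₃ .bot)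
      (hC : SepConj i k C₁ C₃ C) : utSep R C .bot

end SepUpTo

namespace SepUpTo

variable {O : OpSig}

/-! ### Induction on expressions and patterns -/

-- The proof goes through the tower of `WP`: the least class of relations closed under `WP` and
-- under arbitrary intersections. By induction on the tower, every compatible `f` satisfies `f x ≤
-- x` at each tower element `x`. The map sending a relation to the least tower element above it
-- (`towerClosure`) is itself compatible, so it is the companion. Anything pointwise below it is a
-- sound up-to technique, and the functions below it are closed under joins, composition and
-- iteration. All the claims thus reduce to `Tower.utSep_le`: every tower element is closed under
-- `utSep`.
--
-- That is proved by tower induction. Intersections need only monotonicity. For the step, assume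
-- `utSep x ≤ x` and show `utSep (WP x) ≤ WP x`. Two extra facts about a tower element `x` are
-- available here. First, `WP x ≤ x`, needed because only one component of a conjunction moves while
-- the idle pair remains related by `WP x`. Second, `x` is closed under every compatible function,
-- which gives reflexivity and renaming of locations on the right.
--
-- A transition of a conjunction is a response to `⊥`, a termination, or a move of one component
-- (`SepConj.trans_cases`); typing ensures that a component touches only its own store. The weak
-- answer of the matching component is then framed by the other one. Indices in the label stay fresh
-- because environment domains agree, and names stay fresh because of the inclusions of name sets.
-- Locations allocated by the answer may clash with the idle store, so they are renamed first
-- (`SepConj.wTrans_left_ren`), which requires equivariance of the whole transition system.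
--
-- One mismatch remains: the left component may await the opponent while its partner is still
-- computing, so that the other partner cannot move. The partner can then answer an opponent label
-- only by `⊥`, so the left component is already below `⊥`. Hence so is the conjunction, and
-- whatever lies below `⊥` lies below everything.

@[elab_as_elim]
theorem Exp.induct {P : Exp O → Prop} (const : ∀ c, P (.const c)) (var : ∀ n, P (.var n))
    (lam : ∀ T T' e, P e → P (.lam T T' e)) (name : ∀ a, P (.name a))
    (tuple : ∀ es, (∀ e ∈ es, P e) → P (.tuple es))
    (op : ∀ o es, (∀ e ∈ es, P e) → P (.op o es))
    (app : ∀ e e', P e → P e' → P (.app e e'))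
    (ite : ∀ e e₁ e₂, P e → P e₁ → P e₂ → P (.ite e e₁ e₂))
    (new : ∀ v e, P v → P e → P (.new v e)) (deref : ∀ l, P (.deref l))
    (assign : ∀ l e, P e → P (.assign l e))
    (letIn : ∀ n e e', P e → P e' → P (.letIn n e e')) (e : Exp O) : P e :=
  Exp.rec (motive_1 := P) (motive_2 := fun es => ∀ e ∈ es, P e)
    const var lam name tuple op app ite new deref assign letIn
    (by simp) (fun _ _ h hs => by simpa using ⟨h, hs⟩) e

@[elab_as_elim]
theorem Pat.induct {P : Pat → Prop} (const : ∀ c, P (.const c))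
    (tuple : ∀ Ds, (∀ D ∈ Ds, P D) → P (.tuple Ds))
    (hole : ∀ i T T', P (.hole i T T')) (D : Pat) : P D :=
  Pat.rec (motive_1 := P) (motive_2 := fun Ds => ∀ D ∈ Ds, P D)
    const tuple hole (by simp) (fun _ _ h hs => by simpa using ⟨h, hs⟩) D

theorem Exp.insts_eq_map (k : ℕ) (vs es : List (Exp O)) :
    Exp.insts k vs es = es.map (Exp.inst k vs) := by
  induction es with
  | nil => simp [Exp.insts]
  | cons e es ih => simp [Exp.insts, ih]

theorem Exp.openLocs_eq_map (k l : ℕ) (es : List (Exp O)) :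
    Exp.openLocs k l es = es.map (Exp.openLoc k l) := by
  induction es with
  | nil => simp [Exp.openLocs]
  | cons e es ih => simp [Exp.openLocs, ih]

theorem Exp.mem_namess {a : Name} {es : List (Exp O)} :
    a ∈ Exp.namess es ↔ ∃ e ∈ es, a ∈ e.names := by
  induction es with
  | nil => simp [Exp.namess]
  | cons e es ih => simp [Exp.namess, ih]

theorem Exp.namess_subset {A : Set Name} {es : List (Exp O)} :
    Exp.namess es ⊆ A ↔ ∀ e ∈ es, e.names ⊆ A := by
  simp only [Set.subset_def, Exp.mem_namess]
  grind

theorem Pat.fills_eq_map (Γ : Env O) (Ds : List Pat) :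
    Pat.fills Γ Ds = Ds.map (Pat.fill Γ) := by
  induction Ds with
  | nil => simp [Pat.fills]
  | cons D Ds ih => simp [Pat.fills, ih]

theorem Pat.mem_holess {p : ℕ × Ty × Ty} {Ds : List Pat} :
    p ∈ Pat.holess Ds ↔ ∃ D ∈ Ds, p ∈ D.holes := by
  induction Ds with
  | nil => simp [Pat.holess]
  | cons D Ds ih => simp [Pat.holess, ih]

theorem Exp.finite_names (e : Exp O) : e.names.Finite := by
  induction e using Exp.induct with
  | tuple es ih | op o es ih =>
    simp only [Exp.names]
    refine (Set.Finite.biUnion es.finite_toSet ih).subset fun a ha => ?_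
    simpa [Exp.mem_namess] using ha
  | _ => simp_all [Exp.names]

/-! ### Names under substitution, opening and filling -/

theorem Exp.names_inst {A : Set Name} {vs : List (Exp O)} (hvs : ∀ v ∈ vs, v.names ⊆ A)
    (e : Exp O) (k : ℕ) (he : e.names ⊆ A) : (e.inst k vs).names ⊆ A := by
  induction e using Exp.induct generalizing k with
  | var n =>
    simp only [Exp.inst]
    split_ifs
    · simp [Exp.names]
    · cases h : vs[n - k]? with
      | none => simp [Exp.names]
      | some v => simpa using hvs v (List.mem_of_getElem? h)
  | tuple es ih | op o es ih =>
    simp only [Exp.inst, Exp.insts_eq_map, Exp.names, Exp.namess_subset, List.mem_map] at he ⊢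
    rintro _ ⟨e, hm, rfl⟩
    exact ih e hm k (he e hm)
  | _ => simp_all [Exp.inst, Exp.names]

theorem Exp.names_openLoc (e : Exp O) (k l : ℕ) : (e.openLoc k l).names = e.names := by
  induction e using Exp.induct generalizing k with
  | tuple es ih | op o es ih =>
    ext a
    simp only [Exp.openLoc, Exp.openLocs_eq_map, Exp.names, Exp.mem_namess, List.mem_map]
    grind
  | _ => simp_all [Exp.openLoc, Exp.names]

theorem ECtx.names_fill_subset {A : Set Name} (E : ECtx O) (e : Exp O) :
    (E.fill e).names ⊆ A ↔ E.names ⊆ A ∧ e.names ⊆ A := by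
  induction E with
  | hole => simp [ECtx.names, ECtx.fill, Exp.names]
  | tuple vs E es ih | op o vs E es ih =>
    simp only [ECtx.names, ECtx.fill, Exp.names, Exp.namess_subset, List.mem_append,
      List.mem_cons] at ih ⊢
    grind
  | _ =>
    simp only [ECtx.names, ECtx.fill, Exp.names, Set.union_subset_iff] at *
    tauto

/-! ### Values -/

theorem IsFun.isVal {v : Exp O} {T T' : Ty} (h : IsFun v T T') : IsVal v := by
  cases h <;> constructor

theorem IsVal.inst {vs : List (Exp O)} (hvs : ∀ v ∈ vs, IsVal v) {v : Exp O} (hv : IsVal v)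
    (k : ℕ) : IsVal (v.inst k vs) := by
  induction hv with
  | var n =>
    simp only [Exp.inst]
    split_ifs
    · constructor
    · cases h : vs[n - k]? with
      | none => constructor
      | some v => simpa using hvs v (List.mem_of_getElem? h)
  | tuple es h ih =>
    simp only [Exp.inst, Exp.insts_eq_map]
    refine .tuple _ fun e he => ?_
    obtain ⟨e, hm, rfl⟩ := List.mem_map.1 he
    exact ih e hm
  | _ => simp only [Exp.inst]; constructor

theorem IsVal.openLoc {v : Exp O} (hv : IsVal v) (k l : ℕ) : IsVal (v.openLoc k l) := by
  induction hv with
  | tuple es h ih =>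
    simp only [Exp.openLoc, Exp.openLocs_eq_map]
    refine .tuple _ fun e he => ?_
    obtain ⟨e, hm, rfl⟩ := List.mem_map.1 he
    exact ih e hm
  | _ => simp only [Exp.openLoc]; constructor

/-! ### Typing -/

/-- `S'` extends the store typing `S`. -/
def TyLe (S S' : ℕ → Option Ty) : Prop := ∀ l T, S l = some T → S' l = some T

theorem LRef.ty_mono {S S' : ℕ → Option Ty} (h : TyLe S S') {L : List Ty} (L' : List Ty)
    {l : LRef} {T : Ty} (hl : l.ty S L = some T) : l.ty S' (L ++ L') = some T := by
  cases l with
  | free l => exact h l T hl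
  | bound k =>
    simp only [LRef.ty] at hl ⊢
    rw [List.getElem?_append_left (List.getElem?_eq_some_iff.1 hl).1, hl]

section
variable {S : ℕ → Option Ty} {Δ L : List Ty}

theorem HasTy.tuple_map {f : Exp O → Exp O} {es : List (Exp O)} {Ts : List Ty}
    (hlen : es.length = Ts.length) (h : ∀ p ∈ es.zip Ts, HasTy S Δ L (f p.1) p.2) :
    HasTy S Δ L (.tuple (es.map f)) (.prod Ts) := by
  refine .tuple _ _ (by simpa using hlen) fun p hp => ?_
  rw [List.zip_map_left] at hp
  obtain ⟨q, hq, rfl⟩ := List.mem_map.1 hp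
  exact h q hq

theorem HasTy.op_map {f : Exp O → Exp O} {o : O.Op} {es : List (Exp O)}
    (hlen : es.length = (O.args o).length)
    (h : ∀ p ∈ es.zip (O.args o), HasTy S Δ L (f p.1) (.base p.2)) :
    HasTy S Δ L (.op o (es.map f)) (.base (O.res o)) := by
  refine .op _ _ (by simpa using hlen) fun p hp => ?_
  rw [List.zip_map_left] at hp
  obtain ⟨q, hq, rfl⟩ := List.mem_map.1 hp
  exact h q hq

/-- The `List.Forall₂` form can be split at the hole of an evaluation context, unlike the `zip` form
of the typing rule. -/
theorem hasTy_tuple_iff {es : List (Exp O)} {T : Ty} :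
    HasTy S Δ L (.tuple es) T ↔ ∃ Ts, T = .prod Ts ∧ List.Forall₂ (HasTy S Δ L) es Ts := by
  constructor
  · rintro ⟨⟩
    rename_i Ts hlen h
    exact ⟨Ts, rfl, List.forall₂_iff_zip.2 ⟨hlen, fun {a b} hab => h (a, b) hab⟩⟩
  · rintro ⟨Ts, rfl, h⟩
    rw [List.forall₂_iff_zip] at h
    exact .tuple _ _ h.1 fun p hp => h.2 hp

theorem hasTy_op_iff {o : O.Op} {es : List (Exp O)} {T : Ty} :
    HasTy S Δ L (.op o es) T ↔ T = .base (O.res o) ∧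
      List.Forall₂ (fun e b => HasTy S Δ L e (.base b)) es (O.args o) := by
  constructor
  · rintro ⟨⟩
    rename_i hlen h
    exact ⟨rfl, List.forall₂_iff_zip.2 ⟨hlen, fun {a b} hab => h (a, b) hab⟩⟩
  · rintro ⟨rfl, h⟩
    rw [List.forall₂_iff_zip] at h
    exact .op _ _ h.1 fun p hp => h.2 hp

end

/-- De Bruijn contexts grow at their outer end, so the expression needs no shift. -/
theorem HasTy.weaken {S S' : ℕ → Option Ty} (hS : TyLe S S') {Δ L : List Ty} {e : Exp O} {T : Ty}
    (h : HasTy S Δ L e T) (Δ' L' : List Ty) : HasTy S' (Δ ++ Δ') (L ++ L') e T := by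
  induction h with
  | const c => exact .const c
  | var n T h =>
    refine .var n T ?_
    rw [List.getElem?_append_left (List.getElem?_eq_some_iff.1 h).1, h]
  | lam T T' e _ ih => exact .lam T T' e ih
  | name a => exact .name a
  | tuple es Ts hlen _ ih => exact .tuple es Ts hlen ih
  | op o es hlen _ ih => exact .op o es hlen ih
  | app e e' T T' _ _ ih ih' => exact .app _ _ _ _ ih ih'
  | ite e e₁ e₂ T _ _ _ ih ih₁ ih₂ => exact .ite _ _ _ _ ih ih₁ ih₂
  | new v e T T' hv _ _ ih ih' => exact .new _ _ _ _ hv ih ih'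
  | deref l T h => exact .deref _ _ (LRef.ty_mono hS L' h)
  | assign l e T h _ ih => exact .assign _ _ _ (LRef.ty_mono hS L' h) ih
  | letIn Ts e e' T _ _ ih ih' =>
    rw [List.append_assoc] at ih'
    exact .letIn _ _ _ _ ih ih'

theorem HasTy.mono {S S' : ℕ → Option Ty} (hS : TyLe S S') {Δ L : List Ty} {e : Exp O} {T : Ty}
    (h : HasTy S Δ L e T) : HasTy S' Δ L e T := by
  simpa using h.weaken hS [] []

/-- The substituted variables are the outermost ones in scope, so no variable lies beyond them and
the default case of `Exp.inst` is never reached. They must be replaced by values because the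
initialiser of `new` has to remain a value. -/
theorem HasTy.inst {S : ℕ → Option Ty} {Δ₀ L : List Ty} {e : Exp O} {T : Ty}
    (h : HasTy S Δ₀ L e T) {vs : List (Exp O)} {Us : List Ty} (hv : ∀ v ∈ vs, IsVal v)
    (hvs : List.Forall₂ (HasTy S [] []) vs Us) (Δ : List Ty) (hΔ : Δ₀ = Δ ++ Us) :
    HasTy S Δ L (e.inst Δ.length vs) T := by
  induction h generalizing Δ with
  | const c => simp only [Exp.inst]; exact .const c
  | var n T h =>
    subst hΔ
    simp only [Exp.inst]
    split_ifs with hn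
    · rw [List.getElem?_append_left hn] at h
      exact .var _ _ h
    · rw [List.getElem?_append_right (not_lt.1 hn)] at h
      obtain ⟨hlt, hU⟩ := List.getElem?_eq_some_iff.1 h
      have hlt' : n - Δ.length < vs.length := hvs.length_eq ▸ hlt
      rw [List.getElem?_eq_getElem hlt']
      have := hvs.get hlt' hlt
      simp only [List.get_eq_getElem, hU] at this
      simpa using this.weaken (fun _ _ h => h) Δ _
  | lam T T' e _ ih =>
    simp only [Exp.inst]
    exact .lam T T' _ (ih (T :: .arr T T' :: Δ) (by simp [hΔ]))
  | name a => simp only [Exp.inst]; exact .name a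
  | tuple es Ts hlen _ ih =>
    simp only [Exp.inst, Exp.insts_eq_map]
    exact .tuple_map hlen fun p hp => ih p hp Δ hΔ
  | op o es hlen _ ih =>
    simp only [Exp.inst, Exp.insts_eq_map]
    exact .op_map hlen fun p hp => ih p hp Δ hΔ
  | app e e' T T' _ _ ih ih' => simp only [Exp.inst]; exact .app _ _ _ _ (ih Δ hΔ) (ih' Δ hΔ)
  | ite e e₁ e₂ T _ _ _ ih ih₁ ih₂ =>
    simp only [Exp.inst]; exact .ite _ _ _ _ (ih Δ hΔ) (ih₁ Δ hΔ) (ih₂ Δ hΔ)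
  | new v e T T' hv' _ _ ih ih' =>
    simp only [Exp.inst]; exact .new _ _ _ _ (hv'.inst hv _) (ih Δ hΔ) (ih' Δ hΔ)
  | deref l T h => simp only [Exp.inst]; exact .deref _ _ h
  | assign l e T h _ ih => simp only [Exp.inst]; exact .assign _ _ _ h (ih Δ hΔ)
  | letIn Ts e e' T _ _ ih ih' =>
    have := ih' (Ts ++ Δ) (by simp [hΔ])
    rw [List.length_append, add_comm] at this
    simp only [Exp.inst]
    exact .letIn _ _ _ _ (ih Δ hΔ) this

theorem LRef.ty_openAt {S : ℕ → Option Ty} {l : ℕ} {U : Ty} (hl : S l = some U) {L : List Ty}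
    {r : LRef} {T : Ty} (h : r.ty S (L ++ [U]) = some T) :
    (r.openAt L.length l).ty S L = some T := by
  cases r with
  | free l' => exact h
  | bound j =>
    simp only [LRef.ty, LRef.openAt] at h ⊢
    obtain ⟨hlt, _⟩ := List.getElem?_eq_some_iff.1 h
    simp only [List.length_append, List.length_singleton] at hlt
    split_ifs with hj
    · subst hj
      simpa [hl] using h
    · simp only
      rwa [List.getElem?_append_left (by omega)] at h

theorem HasTy.openLoc {S : ℕ → Option Ty} {l : ℕ} {U : Ty} (hl : S l = some U)
    {Δ L₀ : List Ty} {e : Exp O} {T : Ty} (h : HasTy S Δ L₀ e T) (L : List Ty)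
    (hL : L₀ = L ++ [U]) : HasTy S Δ L (e.openLoc L.length l) T := by
  induction h generalizing L with
  | const c => simp only [Exp.openLoc]; exact .const c
  | var n T h => simp only [Exp.openLoc]; exact .var _ _ h
  | lam T T' e _ ih => simp only [Exp.openLoc]; exact .lam T T' _ (ih L hL)
  | name a => simp only [Exp.openLoc]; exact .name a
  | tuple es Ts hlen _ ih =>
    simp only [Exp.openLoc, Exp.openLocs_eq_map]
    exact .tuple_map hlen fun p hp => ih p hp L hL
  | op o es hlen _ ih =>
    simp only [Exp.openLoc, Exp.openLocs_eq_map]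
    exact .op_map hlen fun p hp => ih p hp L hL
  | app e e' T T' _ _ ih ih' => simp only [Exp.openLoc]; exact .app _ _ _ _ (ih L hL) (ih' L hL)
  | ite e e₁ e₂ T _ _ _ ih ih₁ ih₂ =>
    simp only [Exp.openLoc]; exact .ite _ _ _ _ (ih L hL) (ih₁ L hL) (ih₂ L hL)
  | new v e T T' hv' _ _ ih ih' =>
    simp only [Exp.openLoc]
    exact .new _ _ _ _ (hv'.openLoc _ _) (ih L hL) (ih' (T :: L) (by simp [hL]))
  | deref r T h =>
    subst hL
    simp only [Exp.openLoc]; exact .deref _ _ (LRef.ty_openAt hl h)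
  | assign r e T h _ ih =>
    subst hL
    simp only [Exp.openLoc]; exact .assign _ _ _ (LRef.ty_openAt hl h) (ih L rfl)
  | letIn Ts e e' T _ _ ih ih' =>
    simp only [Exp.openLoc]; exact .letIn _ _ _ _ (ih L hL) (ih' L hL)

theorem forall₂_append_cons_left {α β : Type*} {R : α → β → Prop} {l₁ l₂ : List α} {a : α}
    {m : List β} (h : List.Forall₂ R (l₁ ++ a :: l₂) m) :
    ∃ m₁ b m₂, m = m₁ ++ b :: m₂ ∧ List.Forall₂ R l₁ m₁ ∧ R a b ∧ List.Forall₂ R l₂ m₂ := by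
  induction l₁ generalizing m with
  | nil =>
    cases h with | cons h₁ h₂ =>
    exact ⟨[], _, _, rfl, .nil, h₁, h₂⟩
  | cons a' l₁ ih =>
    cases h with | cons h₁ h₂ =>
    obtain ⟨m₁, b, m₂, rfl, h₃, h₄, h₅⟩ := ih h₂
    exact ⟨_ :: m₁, b, m₂, rfl, .cons h₁ h₃, h₄, h₅⟩

/-- Inversion of the typing of a filled context, stable under extension of the store typing. -/
theorem ECtx.hasTy_fill {S : ℕ → Option Ty} (E : ECtx O) {e : Exp O} {T : Ty}
    (h : HasTy S [] [] (E.fill e) T) : ∃ U, HasTy S [] [] e U ∧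
      ∀ S' e', TyLe S S' → HasTy S' [] [] e' U → HasTy S' [] [] (E.fill e') T := by
  induction E generalizing T with
  | hole => exact ⟨T, h, fun _ _ _ h => h⟩
  | tuple vs E es ih =>
    obtain ⟨Ts, rfl, hf⟩ := hasTy_tuple_iff.1 h
    obtain ⟨Ts₁, U', Ts₂, rfl, h₁, h₃, h₄⟩ := forall₂_append_cons_left hf
    obtain ⟨U, hU, hfill⟩ := ih h₃
    refine ⟨U, hU, fun S' e' hS he' => hasTy_tuple_iff.2 ⟨_, rfl, ?_⟩⟩
    exact List.rel_append (h₁.imp fun _ _ h => h.mono hS)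
      (.cons (hfill S' e' hS he') (h₄.imp fun _ _ h => h.mono hS))
  | op o vs E es ih =>
    obtain ⟨rfl, hf⟩ := hasTy_op_iff.1 h
    obtain ⟨Ts₁, U', Ts₂, hargs, h₁, h₃, h₄⟩ := forall₂_append_cons_left hf
    obtain ⟨U, hU, hfill⟩ := ih h₃
    refine ⟨U, hU, fun S' e' hS he' => hasTy_op_iff.2 ⟨rfl, ?_⟩⟩
    rw [hargs]
    exact List.rel_append (h₁.imp fun _ _ h => h.mono hS)
      (.cons (hfill S' e' hS he') (h₄.imp fun _ _ h => h.mono hS))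
  | appL E e ih =>
    cases h with | app _ _ T₁ _ h h' =>
    obtain ⟨U, hU, hfill⟩ := ih h
    exact ⟨U, hU, fun S' e' hS he' => .app _ _ _ _ (hfill S' e' hS he') (h'.mono hS)⟩
  | appR v E ih =>
    cases h with | app _ _ T₁ _ h h' =>
    obtain ⟨U, hU, hfill⟩ := ih h'
    exact ⟨U, hU, fun S' e' hS he' => .app _ _ _ _ (h.mono hS) (hfill S' e' hS he')⟩
  | assign l E ih =>
    cases h with | assign _ _ T₁ h h' =>
    obtain ⟨U, hU, hfill⟩ := ih h'
    exact ⟨U, hU, fun S' e' hS he' => .assign _ _ _ (by simpa using LRef.ty_mono hS [] h)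
      (hfill S' e' hS he')⟩
  | ite E e₁ e₂ ih =>
    cases h with | ite _ _ _ _ h h₁ h₂ =>
    obtain ⟨U, hU, hfill⟩ := ih h
    exact ⟨U, hU, fun S' e' hS he' => .ite _ _ _ _ (hfill S' e' hS he') (h₁.mono hS) (h₂.mono hS)⟩
  | letIn n E e ih =>
    cases h with | letIn Ts _ _ _ h h' =>
    obtain ⟨U, hU, hfill⟩ := ih h
    exact ⟨U, hU, fun S' e' hS he' => .letIn _ _ _ _ (hfill S' e' hS he') (h'.mono hS)⟩

/-- The typing of a continuation is stable under extension of the store typing: it is enough to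
fill its hole with one expression of the right type. -/
theorem ECtx.hasTy_fill_mono {S S' : ℕ → Option Ty} (hS : TyLe S S') {E : ECtx O} {T T' : Ty}
    (h : ∀ e₀, HasTy S [] [] e₀ T → HasTy S [] [] (E.fill e₀) T') (e : Exp O)
    (he : HasTy S' [] [] e T) : HasTy S' [] [] (E.fill e) T' := by
  -- The hypothesis concerns expressions typed in `S` only, so it is tested on one that has type `T`
  -- in every store typing: an abstract name of codomain `T` applied to unit. The annotation of the
  -- name then forces `U = T`.
  obtain ⟨U, hU, hfill⟩ := E.hasTy_fill
    (h (.app (.name ⟨0, .base .unit, T⟩) (.const .unit)) (.app _ _ _ _ (.name _) (.const .unit)))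
  cases hU with | app _ _ _ _ h₁ _ =>
  cases h₁
  exact hfill S' e hS he

/-! ### Subject reduction -/

theorem RedBase.preserves {s s' : Store O} {e e' : Exp O} (h : RedBase s e s' e')
    {S : ℕ → Option Ty} (hs : StoreTyping s S) {T : Ty} (he : HasTy S [] [] e T) :
    ∃ S', TyLe S S' ∧ StoreTyping s' S' ∧ HasTy S' [] [] e' T := by
  cases h with
  | op o cs w h =>
    obtain ⟨rfl, hf⟩ := hasTy_op_iff.1 he
    have : w.ty = O.res o := by
      refine O.eval_ty o cs w ?_ h
      clear h he
      generalize O.args o = bs at hf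
      induction cs generalizing bs with
      | nil => cases hf; rfl
      | cons c cs ih =>
        cases hf with | cons h₁ h₂ =>
        cases h₁
        simp [ih _ h₂]
    exact ⟨S, fun _ _ h => h, hs, this ▸ .const w⟩
  | beta T₁ T₁' e v hv =>
    cases he with | app _ _ _ _ h h' =>
    have hl := h
    cases h with | lam _ _ _ h =>
    refine ⟨S, fun _ _ h => h, hs, h.inst (Us := [T₁, .arr T₁ T]) ?_ ?_ [] rfl⟩
    · simpa using ⟨hv, .lam _ _ _⟩
    · exact .cons h' (.cons hl .nil)
  | letIn vs e hv =>
    generalize hn : vs.length = n at he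
    cases he with | letIn Ts _ _ _ h h' =>
    obtain ⟨_, hT, hf⟩ := hasTy_tuple_iff.1 h
    cases hT
    exact ⟨S, fun _ _ h => h, hs, h'.inst hv hf [] (by simp)⟩
  | new l v e hv hl =>
    cases he with | new _ _ T₁ _ _ h h' =>
    -- The location is fresh for the store, hence untyped, so typing it now extends `S`.
    have hSl : S l = none := by
      by_contra hne
      exact hl ((hs.dom l).1 (Option.ne_none_iff_exists'.1 hne))
    have hle : TyLe S (Function.update S l (some T₁)) := by
      intro l' T' h
      rw [Function.update_of_ne, h]
      rintro rfl
      simp [hSl] at h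
    refine ⟨_, hle, ⟨fun l' => ?_, fun l' v' T' h₁ h₂ => ?_⟩, ?_⟩
    · by_cases hl' : l' = l
      · subst hl'; simp
      · simp [hs.dom, hl']
    · by_cases hl' : l' = l
      · subst hl'
        simp only [Finmap.lookup_insert, Option.some.injEq, Function.update_self] at h₁ h₂
        subst h₁ h₂
        exact ⟨hv, h.mono hle⟩
      · rw [Finmap.lookup_insert_of_ne _ hl'] at h₁
        rw [Function.update_of_ne hl'] at h₂
        exact ⟨(hs.typed _ _ _ h₁ h₂).1, (hs.typed _ _ _ h₁ h₂).2.mono hle⟩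
    · exact (h'.mono hle).openLoc (by simp) [] rfl
  | deref l _ h =>
    cases he with | deref _ _ h' =>
    exact ⟨S, fun _ _ h => h, hs, (hs.typed _ _ _ h h').2⟩
  | assign l v hv =>
    cases he with | assign _ _ T₁ h h' =>
    refine ⟨S, fun _ _ h => h, ⟨fun l' => ?_, fun l' v' T' h₁ h₂ => ?_⟩, .const .unit⟩
    · rw [hs.dom, Finmap.mem_insert]
      constructor
      · exact Or.inr
      · rintro (rfl | h₁)
        · exact (hs.dom _).1 ⟨_, h⟩
        · exact h₁
    · by_cases hl' : l' = l
      · subst hl'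
        simp only [Finmap.lookup_insert, Option.some.injEq] at h₁
        subst h₁
        have : T₁ = T' := Option.some.inj (h.symm.trans h₂)
        exact ⟨hv, this ▸ h'⟩
      · rw [Finmap.lookup_insert_of_ne _ hl'] at h₁
        exact hs.typed _ _ _ h₁ h₂
  | iteTrue e₂ =>
    cases he with | ite _ _ _ _ h h₁ h₂ =>
    exact ⟨S, fun _ _ h => h, hs, h₁⟩
  | iteFalse e₁ =>
    cases he with | ite _ _ _ _ h h₁ h₂ =>
    exact ⟨S, fun _ _ h => h, hs, h₂⟩

theorem Red.preserves {s s' : Store O} {e e' : Exp O} (h : Red s e s' e')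
    {S : ℕ → Option Ty} (hs : StoreTyping s S) {T : Ty} (he : HasTy S [] [] e T) :
    ∃ S', TyLe S S' ∧ StoreTyping s' S' ∧ HasTy S' [] [] e' T := by
  cases h with | ctx E hE _ _ e e' h =>
  obtain ⟨U, hU, hfill⟩ := E.hasTy_fill he
  obtain ⟨S', hS, hs', he'⟩ := h.preserves hs hU
  exact ⟨S', hS, hs', hfill S' e' hS he'⟩

/-- All abstract names of the store are in `A`. -/
def StoreNames (A : Set Name) (s : Store O) : Prop := ∀ l v, s.lookup l = some v → v.names ⊆ A

theorem StoreNames.insert {A : Set Name} {s : Store O} (hs : StoreNames A s) {v : Exp O}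
    (hv : v.names ⊆ A) (l : ℕ) : StoreNames A (s.insert l v) := by
  intro l' v' h
  by_cases hl' : l' = l
  · subst hl'
    rw [Finmap.lookup_insert] at h
    cases h
    exact hv
  · rw [Finmap.lookup_insert_of_ne _ hl'] at h
    exact hs _ _ h

theorem RedBase.names {s s' : Store O} {e e' : Exp O} (h : RedBase s e s' e') {A : Set Name}
    (hs : StoreNames A s) (he : e.names ⊆ A) : StoreNames A s' ∧ e'.names ⊆ A := by
  cases h with
  | op o cs w h => simpa [Exp.names] using hs
  | beta T₁ T₁' e v hv =>
    simp only [Exp.names, Set.union_subset_iff] at he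
    refine ⟨hs, Exp.names_inst ?_ _ _ he.1⟩
    simpa [Exp.names] using he.symm
  | letIn vs e hv =>
    simp only [Exp.names, Set.union_subset_iff, Exp.namess_subset] at he
    exact ⟨hs, Exp.names_inst he.1 _ _ he.2⟩
  | new l v e hv hl =>
    simp only [Exp.names, Set.union_subset_iff] at he
    exact ⟨hs.insert he.1 l, by simpa [Exp.names_openLoc] using he.2⟩
  | deref l _ h => exact ⟨hs, hs _ _ h⟩
  | assign l v hv => exact ⟨hs.insert (by simpa [Exp.names] using he) l, by simp [Exp.names]⟩
  | iteTrue e₂ =>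
    simp only [Exp.names, Set.union_subset_iff] at he
    exact ⟨hs, he.1.2⟩
  | iteFalse e₁ =>
    simp only [Exp.names, Set.union_subset_iff] at he
    exact ⟨hs, he.2⟩

theorem Red.names {s s' : Store O} {e e' : Exp O} (h : Red s e s' e') {A : Set Name}
    (hs : StoreNames A s) (he : e.names ⊆ A) : StoreNames A s' ∧ e'.names ⊆ A := by
  cases h with | ctx E hE _ _ e e' h =>
  rw [ECtx.names_fill_subset] at he ⊢
  obtain ⟨h₁, h₂⟩ := h.names hs he.2
  exact ⟨h₁, he.1, h₂⟩

theorem RedBase.mem_store {s s' : Store O} {e e' : Exp O} (h : RedBase s e s' e') {l : ℕ}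
    (hl : l ∈ s) : l ∈ s' := by
  cases h <;> simp_all

theorem Red.mem_store {s s' : Store O} {e e' : Exp O} (h : Red s e s' e') {l : ℕ}
    (hl : l ∈ s) : l ∈ s' := by
  cases h with | ctx _ _ _ _ _ _ h => exact h.mem_store hl

/-! ### Framing of reductions -/

/-- Disjointness is required of the final store, so that an allocated location also avoids `s₀`. -/
theorem RedBase.frame {s s' s₀ : Store O} {e e' : Exp O} (h : RedBase s e s' e')
    (hs : s'.Disjoint s₀) : RedBase (s ∪ s₀) e (s' ∪ s₀) e' := by
  cases h with
  | op o cs w h => exact .op _ _ _ _ h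
  | beta T₁ T₁' e v hv => exact .beta _ _ _ _ _ hv
  | letIn vs e hv => exact .letIn _ _ _ hv
  | new l v e hv hl =>
    rw [← Finmap.insert_union]
    refine .new _ _ _ _ hv ?_
    rw [Finmap.mem_union]
    rintro (h | h)
    · exact hl h
    · exact hs l (by simp) h
  | deref l _ h => exact .deref _ _ _ (Finmap.lookup_union_left (Finmap.mem_of_lookup_eq_some h) ▸ h)
  | assign l v hv =>
    rw [← Finmap.insert_union]
    exact .assign _ _ _ hv
  | iteTrue e₂ => exact .iteTrue _ _ _
  | iteFalse e₁ => exact .iteFalse _ _ _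

theorem Red.frame {s s' s₀ : Store O} {e e' : Exp O} (h : Red s e s' e')
    (hs : s'.Disjoint s₀) : Red (s ∪ s₀) e (s' ∪ s₀) e' := by
  cases h with | ctx E hE _ _ e e' h => exact .ctx E hE _ _ _ _ (h.frame hs)

theorem Finmap.disjoint_insert {s s₀ : Store O} (hs : s.Disjoint s₀) {l : ℕ} (hl : l ∉ s₀)
    (v : Exp O) : (s.insert l v).Disjoint s₀ := by
  intro l' h
  rcases (Finmap.mem_insert).1 h with rfl | h
  · exact hl
  · exact hs l' h

/-- Typing under `S` confines reads and writes to `s`. It is needed for assignment as well, whose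
reduction rule does not ask that the location exist. -/
theorem RedBase.unframe {s s₀ s' : Store O} {e e' : Exp O} (h : RedBase (s ∪ s₀) e s' e')
    (hd : s.Disjoint s₀) {S : ℕ → Option Ty} (hs : StoreTyping s S) {T : Ty}
    (he : HasTy S [] [] e T) :
    ∃ s₁, RedBase s e s₁ e' ∧ s' = s₁ ∪ s₀ ∧ s₁.Disjoint s₀ := by
  cases h with
  | op o cs w h => exact ⟨s, .op _ _ _ _ h, rfl, hd⟩
  | beta T₁ T₁' e v hv => exact ⟨s, .beta _ _ _ _ _ hv, rfl, hd⟩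
  | letIn vs e hv => exact ⟨s, .letIn _ _ _ hv, rfl, hd⟩
  | new l v e hv hl =>
    rw [Finmap.mem_union, not_or] at hl
    exact ⟨s.insert l v, .new _ _ _ _ hv hl.1, Finmap.insert_union, Finmap.disjoint_insert hd hl.2 v⟩
  | deref l _ h =>
    cases he with | deref _ _ h' =>
    rw [Finmap.lookup_union_left ((hs.dom l).1 ⟨_, h'⟩)] at h
    exact ⟨s, .deref _ _ _ h, rfl, hd⟩
  | assign l v hv =>
    cases he with | assign _ _ _ h' _ =>
    exact ⟨s.insert l v, .assign _ _ _ hv, Finmap.insert_union,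
      Finmap.disjoint_insert hd (hd l ((hs.dom l).1 ⟨_, h'⟩)) v⟩
  | iteTrue e₂ => exact ⟨s, .iteTrue _ _ _, rfl, hd⟩
  | iteFalse e₁ => exact ⟨s, .iteFalse _ _ _, rfl, hd⟩

theorem Red.unframe {s s₀ s' : Store O} {e e' : Exp O} (h : Red (s ∪ s₀) e s' e')
    (hd : s.Disjoint s₀) {S : ℕ → Option Ty} (hs : StoreTyping s S) {T : Ty}
    (he : HasTy S [] [] e T) :
    ∃ s₁, Red s e s₁ e' ∧ s' = s₁ ∪ s₀ ∧ s₁.Disjoint s₀ := by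
  generalize hs₂ : s ∪ s₀ = s₂ at h
  cases h with | ctx E hE _ _ e e' h =>
  subst hs₂
  obtain ⟨U, hU, -⟩ := E.hasTy_fill he
  obtain ⟨s₁, h₁, h₂, h₃⟩ := h.unframe hd hs hU
  exact ⟨s₁, .ctx E hE _ _ _ _ h₁, h₂, h₃⟩

/-! ### Ultimate patterns -/

theorem Pat.isVal_fill {Γ : Env O} (D : Pat)
    (h : ∀ i T T', (i, T, T') ∈ D.holes → ∃ w, Γ.lookup i = some w ∧ IsFun w T T') :
    IsVal (D.fill Γ) := by
  induction D using Pat.induct with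
  | const c => exact .const c
  | hole i T T' =>
    obtain ⟨w, hw, hf⟩ := h i T T' (by simp [Pat.holes])
    simpa [Pat.fill, hw] using hf.isVal
  | tuple Ds ih =>
    simp only [Pat.fill, Pat.fills_eq_map]
    refine .tuple _ fun e he => ?_
    obtain ⟨D, hD, rfl⟩ := List.mem_map.1 he
    refine ih D hD fun i T T' hm => h i T T' ?_
    simp only [Pat.holes, Pat.mem_holess]
    exact ⟨D, hD, hm⟩

theorem Pat.hasTy_hole {Γ : Env O} {S : ℕ → Option Ty} {A : Set Name} (D : Pat) {T : Ty}
    (h : HasTy S [] [] (D.fill Γ) T) (hA : (D.fill Γ).names ⊆ A) {p : ℕ × Ty × Ty}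
    (hp : p ∈ D.holes) {w : Exp O} (hw : Γ.lookup p.1 = some w) :
    (∃ T, HasTy S [] [] w T) ∧ w.names ⊆ A := by
  induction D using Pat.induct generalizing T with
  | const c => simp [Pat.holes] at hp
  | hole i T' T'' =>
    simp only [Pat.holes, List.mem_singleton] at hp
    subst hp
    simp only [Pat.fill, hw, Option.getD_some] at h hA
    exact ⟨⟨_, h⟩, hA⟩
  | tuple Ds ih =>
    simp only [Pat.holes, Pat.mem_holess] at hp
    obtain ⟨D, hD, hm⟩ := hp
    simp only [Pat.fill, Pat.fills_eq_map, Exp.names, Exp.namess_subset] at h hA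
    obtain ⟨Ts, -, hf⟩ := hasTy_tuple_iff.1 h
    have : ∃ T, HasTy S [] [] (D.fill Γ) T := by
      obtain ⟨n, hn, hDn⟩ := List.getElem_of_mem (List.mem_map_of_mem (f := Pat.fill Γ) hD)
      have := hf.get hn (hf.length_eq ▸ hn)
      simp only [List.get_eq_getElem, hDn] at this
      exact ⟨_, this⟩
    obtain ⟨T', hT'⟩ := this
    exact ih D hD hT' (hA _ (List.mem_map_of_mem hD)) hm

theorem UltPat.isVal {v : Exp O} {D : Pat} {Γ : Env O} (h : UltPat v D Γ) : IsVal v :=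
  h.fill ▸ D.isVal_fill h.isFun

/-- Each function stored under an index occurs in `v` at a hole of `D`, so it inherits typability
and name bounds from `v`. This keeps the environment well-formed after a proponent move. -/
theorem UltPat.lookup {v : Exp O} {D : Pat} {Γ : Env O} (h : UltPat v D Γ) {S : ℕ → Option Ty}
    {T : Ty} (hT : HasTy S [] [] v T) {A : Set Name} (hA : v.names ⊆ A) {i : ℕ} {w : Exp O}
    (hw : Γ.lookup i = some w) : (IsVal w ∧ ∃ T, HasTy S [] [] w T) ∧ w.names ⊆ A := by
  have hi := (h.dom i).1 (Finmap.mem_of_lookup_eq_some hw)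
  obtain ⟨⟨i, T₁, T₂⟩, hp, rfl⟩ := List.mem_map.1 hi
  obtain ⟨w', hw', hf⟩ := h.isFun _ _ _ hp
  cases hw.symm.trans hw'
  rw [← h.fill] at hT hA
  obtain ⟨h₁, h₂⟩ := D.hasTy_hole hT hA hp hw
  exact ⟨⟨hf.isVal, h₁⟩, h₂⟩

theorem OppVal.isVal {T : Ty} {u : Exp O} (h : OppVal T u) : IsVal u := by
  obtain ⟨D, as, h, -⟩ := h
  exact h.isVal

theorem OppVal.hasTy {T : Ty} {u : Exp O} (h : OppVal T u) (S : ℕ → Option Ty) :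
    HasTy S [] [] u T := by
  obtain ⟨D, as, -, -, -, h⟩ := h
  exact h.mono (by simp [TyLe])

/-! ### Renaming of locations -/

/-- Rename a free location. -/
def LRef.ren (ρ : ℕ ↪ ℕ) : LRef → LRef
  | .free l => .free (ρ l)
  | .bound k => .bound k

mutual
/-- Rename the free locations of an expression. -/
def Exp.ren (ρ : ℕ ↪ ℕ) : Exp O → Exp O
  | .const c => .const c
  | .var n => .var n
  | .lam T T' e => .lam T T' (e.ren ρ)
  | .name a => .name a
  | .tuple es => .tuple (Exp.rens ρ es)
  | .op o es => .op o (Exp.rens ρ es)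
  | .app e e' => .app (e.ren ρ) (e'.ren ρ)
  | .ite e e₁ e₂ => .ite (e.ren ρ) (e₁.ren ρ) (e₂.ren ρ)
  | .new v e => .new (v.ren ρ) (e.ren ρ)
  | .deref r => .deref (r.ren ρ)
  | .assign r e => .assign (r.ren ρ) (e.ren ρ)
  | .letIn n e e' => .letIn n (e.ren ρ) (e'.ren ρ)
/-- `Exp.ren` on lists of expressions. -/
def Exp.rens (ρ : ℕ ↪ ℕ) : List (Exp O) → List (Exp O)
  | [] => []
  | e :: es => e.ren ρ :: Exp.rens ρ es
end

theorem Exp.rens_eq_map (ρ : ℕ ↪ ℕ) (es : List (Exp O)) :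
    Exp.rens ρ es = es.map (Exp.ren ρ) := by
  induction es with
  | nil => simp [Exp.rens]
  | cons e es ih => simp [Exp.rens, ih]

/-- Rename the free locations of an evaluation context. -/
def ECtx.ren (ρ : ℕ ↪ ℕ) : ECtx O → ECtx O
  | .hole => .hole
  | .tuple vs E es => .tuple (vs.map (Exp.ren ρ)) (E.ren ρ) (es.map (Exp.ren ρ))
  | .op o vs E es => .op o (vs.map (Exp.ren ρ)) (E.ren ρ) (es.map (Exp.ren ρ))
  | .appL E e => .appL (E.ren ρ) (e.ren ρ)
  | .appR v E => .appR (v.ren ρ) (E.ren ρ)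
  | .assign l E => .assign (l.ren ρ) (E.ren ρ)
  | .ite E e₁ e₂ => .ite (E.ren ρ) (e₁.ren ρ) (e₂.ren ρ)
  | .letIn n E e => .letIn n (E.ren ρ) (e.ren ρ)

/-- Map the keys and values of a finite map. -/
def mapFin (g : ℕ ↪ ℕ) (f : Exp O → Exp O) (s : Store O) : Store O :=
  ⟨s.entries.map fun p => ⟨g p.1, f p.2⟩, by
    rw [← Multiset.nodup_keys]
    have := (Multiset.nodup_keys.2 s.nodupKeys).map g.injective
    simpa [Multiset.keys, Multiset.map_map, Function.comp_def] using this⟩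

theorem lookup_mapFin_eq_some {g : ℕ ↪ ℕ} {f : Exp O → Exp O} {s : Store O} {l : ℕ} {v : Exp O} :
    (mapFin g f s).lookup l = some v ↔ ∃ l' v', s.lookup l' = some v' ∧ g l' = l ∧ f v' = v := by
  simp only [Finmap.lookup_eq_some_iff, mapFin, Multiset.mem_map, Sigma.mk.injEq, heq_eq_eq,
    Sigma.exists]

theorem lookup_mapFin (g : ℕ ↪ ℕ) (f : Exp O → Exp O) (s : Store O) (l : ℕ) :
    (mapFin g f s).lookup (g l) = (s.lookup l).map f := by
  ext v
  rw [lookup_mapFin_eq_some]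
  simp [g.injective.eq_iff]

theorem mem_mapFin {g : ℕ ↪ ℕ} {f : Exp O → Exp O} {s : Store O} {l : ℕ} :
    l ∈ mapFin g f s ↔ ∃ l' ∈ s, g l' = l := by
  simp only [Finmap.mem_iff, lookup_mapFin_eq_some]
  grind

theorem lookup_mapFin_of_notMem_range {g : ℕ ↪ ℕ} (f : Exp O → Exp O) (s : Store O) {l : ℕ}
    (hl : l ∉ Set.range g) : (mapFin g f s).lookup l = none := by
  rw [Finmap.lookup_eq_none, mem_mapFin]
  rintro ⟨l', -, rfl⟩
  exact hl ⟨l', rfl⟩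

theorem mapFin_insert (g : ℕ ↪ ℕ) (f : Exp O → Exp O) (s : Store O) (l : ℕ) (v : Exp O) :
    mapFin g f (s.insert l v) = (mapFin g f s).insert (g l) (f v) := by
  refine Finmap.ext_lookup fun l' => ?_
  by_cases hl : l' ∈ Set.range g
  · obtain ⟨l', rfl⟩ := hl
    rw [lookup_mapFin]
    by_cases h : l' = l
    · subst h
      simp
    · rw [Finmap.lookup_insert_of_ne _ h, Finmap.lookup_insert_of_ne _ (g.injective.ne h),
        lookup_mapFin]
  · have hne : l' ≠ g l := by
      rintro rfl
      exact hl ⟨l, rfl⟩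
    rw [Finmap.lookup_insert_of_ne _ hne, lookup_mapFin_of_notMem_range _ _ hl,
      lookup_mapFin_of_notMem_range _ _ hl]

theorem mapFin_union (g : ℕ ↪ ℕ) (f : Exp O → Exp O) (s s' : Store O) :
    mapFin g f (s ∪ s') = mapFin g f s ∪ mapFin g f s' := by
  refine Finmap.ext_lookup fun l => ?_
  by_cases hl : l ∈ Set.range g
  · obtain ⟨l, rfl⟩ := hl
    by_cases h : l ∈ s
    · rw [lookup_mapFin, Finmap.lookup_union_left h,
        Finmap.lookup_union_left (mem_mapFin.2 ⟨l, h, rfl⟩), lookup_mapFin]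
    · rw [lookup_mapFin, Finmap.lookup_union_right h, Finmap.lookup_union_right, lookup_mapFin]
      rw [mem_mapFin]
      rintro ⟨l', h', he⟩
      exact h (g.injective he ▸ h')
  · rw [lookup_mapFin_of_notMem_range _ _ hl, eq_comm, Finmap.lookup_eq_none, Finmap.mem_union,
      mem_mapFin, mem_mapFin]
    rintro (⟨l', -, rfl⟩ | ⟨l', -, rfl⟩) <;> exact hl ⟨l', rfl⟩

theorem mapFin_disjoint (g : ℕ ↪ ℕ) (f : Exp O → Exp O) {s s' : Store O} (h : s.Disjoint s') :
    (mapFin g f s).Disjoint (mapFin g f s') := by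
  intro l hl hl'
  obtain ⟨l, h₁, rfl⟩ := mem_mapFin.1 hl
  obtain ⟨l', h₂, he⟩ := mem_mapFin.1 hl'
  exact h l h₁ (g.injective he ▸ h₂)

/-- If `g` fixes the keys and `f` fixes the values of `s`, then `mapFin` fixes `s`. -/
theorem mapFin_eq_self {g : ℕ ↪ ℕ} {f : Exp O → Exp O} {s : Store O}
    (h : ∀ l v, s.lookup l = some v → g l = l ∧ f v = v) : mapFin g f s = s := by
  refine Finmap.ext_lookup fun l => Option.ext fun v => ?_
  rw [lookup_mapFin_eq_some]
  grind

/-- Rename the locations in the values of an environment. -/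
def Env.ren (ρ : ℕ ↪ ℕ) (Γ : Env O) : Env O := mapFin (.refl ℕ) (Exp.ren ρ) Γ

/-- Rename the locations of a store. -/
def Store.ren (ρ : ℕ ↪ ℕ) (s : Store O) : Store O := mapFin ρ (Exp.ren ρ) s

theorem Env.lookup_ren (ρ : ℕ ↪ ℕ) (Γ : Env O) (i : ℕ) :
    (Env.ren ρ Γ).lookup i = (Γ.lookup i).map (Exp.ren ρ) :=
  lookup_mapFin (.refl ℕ) _ Γ i

theorem Env.mem_ren {ρ : ℕ ↪ ℕ} {Γ : Env O} {i : ℕ} : i ∈ Env.ren ρ Γ ↔ i ∈ Γ := by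
  simp [Env.ren, mem_mapFin]

-- Compatibility of renaming with syntax, typing and reduction.

theorem IsVal.ren (ρ : ℕ ↪ ℕ) {v : Exp O} (hv : IsVal v) : IsVal (v.ren ρ) := by
  induction hv with
  | tuple es h ih =>
    simp only [Exp.ren, Exp.rens_eq_map]
    refine .tuple _ fun e he => ?_
    obtain ⟨e, hm, rfl⟩ := List.mem_map.1 he
    exact ih e hm
  | _ => simp only [Exp.ren]; constructor

theorem IsFun.ren (ρ : ℕ ↪ ℕ) {v : Exp O} {T T' : Ty} (h : IsFun v T T') :
    IsFun (v.ren ρ) T T' := by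
  cases h <;> simp only [Exp.ren] <;> constructor

theorem Exp.ren_inst (ρ : ℕ ↪ ℕ) (vs : List (Exp O)) (e : Exp O) (k : ℕ) :
    (e.inst k vs).ren ρ = (e.ren ρ).inst k (vs.map (Exp.ren ρ)) := by
  induction e using Exp.induct generalizing k with
  | var n =>
    simp only [Exp.inst, Exp.ren]
    split_ifs
    · simp [Exp.ren]
    · cases h : vs[n - k]? <;> simp [h, Exp.ren]
  | tuple es ih | op o es ih =>
    simp only [Exp.inst, Exp.insts_eq_map, Exp.ren, Exp.rens_eq_map, List.map_map]
    congr 1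
    exact List.map_congr_left fun e he => ih e he k
  | _ => simp_all [Exp.inst, Exp.ren]

theorem LRef.ren_openAt (ρ : ℕ ↪ ℕ) (r : LRef) (k l : ℕ) :
    (r.openAt k l).ren ρ = (r.ren ρ).openAt k (ρ l) := by
  cases r with
  | free l' => rfl
  | bound j => simp only [LRef.openAt, LRef.ren]; split_ifs <;> rfl

theorem Exp.ren_openLoc (ρ : ℕ ↪ ℕ) (e : Exp O) (k l : ℕ) :
    (e.openLoc k l).ren ρ = (e.ren ρ).openLoc k (ρ l) := by
  induction e using Exp.induct generalizing k with
  | tuple es ih | op o es ih =>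
    simp only [Exp.openLoc, Exp.openLocs_eq_map, Exp.ren, Exp.rens_eq_map, List.map_map]
    congr 1
    exact List.map_congr_left fun e he => ih e he k
  | _ => simp_all [Exp.openLoc, Exp.ren, LRef.ren_openAt]

theorem ECtx.ren_fill (ρ : ℕ ↪ ℕ) (E : ECtx O) (e : Exp O) :
    (E.fill e).ren ρ = (E.ren ρ).fill (e.ren ρ) := by
  induction E <;> simp_all [ECtx.fill, ECtx.ren, Exp.ren, Exp.rens_eq_map]

theorem ECtx.Valid.ren (ρ : ℕ ↪ ℕ) {E : ECtx O} (h : E.Valid) : (E.ren ρ).Valid := by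
  induction E with
  | tuple vs E es ih | op o vs E es ih =>
    refine ⟨fun v hv => ?_, ih h.2⟩
    obtain ⟨v, hm, rfl⟩ := List.mem_map.1 hv
    exact (h.1 v hm).ren ρ
  | hole => trivial
  | appR v E ih => exact ⟨h.1.ren ρ, ih h.2⟩
  | appL E e ih | assign l E ih | ite E e₁ e₂ ih | letIn n E e ih => exact ih h

theorem LRef.ty_ren {ρ : ℕ ↪ ℕ} {S S' : ℕ → Option Ty}
    (h : ∀ l T, S l = some T → S' (ρ l) = some T) {L : List Ty} {r : LRef} {T : Ty}
    (hr : r.ty S L = some T) : (r.ren ρ).ty S' L = some T := by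
  cases r with
  | free l => exact h l T hr
  | bound k => exact hr

theorem HasTy.ren {ρ : ℕ ↪ ℕ} {S S' : ℕ → Option Ty}
    (hS : ∀ l T, S l = some T → S' (ρ l) = some T) {Δ L : List Ty} {e : Exp O} {T : Ty}
    (h : HasTy S Δ L e T) : HasTy S' Δ L (e.ren ρ) T := by
  induction h with
  | const c => simp only [Exp.ren]; exact .const c
  | var n T h => simp only [Exp.ren]; exact .var _ _ h
  | lam T T' e _ ih => simp only [Exp.ren]; exact .lam T T' _ ih
  | name a => simp only [Exp.ren]; exact .name a
  | tuple es Ts hlen _ ih => simp only [Exp.ren, Exp.rens_eq_map]; exact .tuple_map hlen ih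
  | op o es hlen _ ih => simp only [Exp.ren, Exp.rens_eq_map]; exact .op_map hlen ih
  | app e e' T T' _ _ ih ih' => simp only [Exp.ren]; exact .app _ _ _ _ ih ih'
  | ite e e₁ e₂ T _ _ _ ih ih₁ ih₂ => simp only [Exp.ren]; exact .ite _ _ _ _ ih ih₁ ih₂
  | new v e T T' hv _ _ ih ih' => simp only [Exp.ren]; exact .new _ _ _ _ (hv.ren ρ) ih ih'
  | deref r T h => simp only [Exp.ren]; exact .deref _ _ (LRef.ty_ren hS h)
  | assign r e T h _ ih => simp only [Exp.ren]; exact .assign _ _ _ (LRef.ty_ren hS h) ih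
  | letIn Ts e e' T _ _ ih ih' => simp only [Exp.ren]; exact .letIn _ _ _ _ ih ih'

theorem LRef.ren_eq_self {ρ : ℕ ↪ ℕ} {S : ℕ → Option Ty} (hρ : ∀ l T, S l = some T → ρ l = l)
    {L : List Ty} {r : LRef} {T : Ty} (hr : r.ty S L = some T) : r.ren ρ = r := by
  cases r with
  | free l => simp only [LRef.ren, hρ l T hr]
  | bound k => rfl

theorem map_eq_self_of_zip {α β : Type*} {f : α → α} {l : List α} {m : List β}
    (hlen : l.length = m.length) (h : ∀ p ∈ l.zip m, f p.1 = p.1) : l.map f = l := by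
  induction l generalizing m with
  | nil => rfl
  | cons a l ih =>
    cases m with
    | nil => simp at hlen
    | cons b m =>
      simp only [List.zip_cons_cons, List.mem_cons, forall_eq_or_imp] at h
      simp [h.1, ih (by simpa using hlen) h.2]

/-- A renaming that fixes the typed locations fixes all well-typed expressions. -/
theorem HasTy.ren_eq_self {ρ : ℕ ↪ ℕ} {S : ℕ → Option Ty} (hρ : ∀ l T, S l = some T → ρ l = l)
    {Δ L : List Ty} {e : Exp O} {T : Ty} (h : HasTy S Δ L e T) : e.ren ρ = e := by
  induction h with
  | tuple es Ts hlen _ ih => simp only [Exp.ren, Exp.rens_eq_map, map_eq_self_of_zip hlen ih]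
  | op o es hlen _ ih => simp only [Exp.ren, Exp.rens_eq_map, map_eq_self_of_zip hlen ih]
  | deref r T h => simp only [Exp.ren, LRef.ren_eq_self hρ h]
  | assign r e T h _ ih => simp only [Exp.ren, LRef.ren_eq_self hρ h, ih]
  | _ => simp_all [Exp.ren]

/-- One filling suffices: renaming commutes with filling, so equality can be read off along the path
to the hole. -/
theorem ECtx.ren_eq_self {ρ : ℕ ↪ ℕ} (E : ECtx O) {e : Exp O}
    (h : (E.fill e).ren ρ = E.fill e) : E.ren ρ = E := by
  induction E with
  | hole => rfl
  | tuple vs E es ih | op o vs E es ih =>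
    simp only [ECtx.fill, Exp.ren, Exp.rens_eq_map, List.map_append, List.map_cons,
      Exp.tuple.injEq, Exp.op.injEq, true_and] at h
    obtain ⟨h₁, h₂⟩ := List.append_inj h (by simp)
    simp only [List.cons.injEq] at h₂
    simp [ECtx.ren, h₁, h₂.2, ih h₂.1]
  | _ => simp_all [ECtx.fill, ECtx.ren, Exp.ren]

theorem Pat.fill_ren (ρ : ℕ ↪ ℕ) {Γ : Env O} (D : Pat) :
    D.fill (Env.ren ρ Γ) = (D.fill Γ).ren ρ := by
  induction D using Pat.induct with
  | const c => simp [Pat.fill, Exp.ren]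
  | hole i T T' =>
    simp only [Pat.fill, Env.lookup_ren]
    cases Γ.lookup i <;> simp [Exp.ren]
  | tuple Ds ih =>
    simp only [Pat.fill, Pat.fills_eq_map, Exp.ren, Exp.rens_eq_map, List.map_map]
    congr 1
    exact List.map_congr_left ih

theorem UltPat.ren (ρ : ℕ ↪ ℕ) {v : Exp O} {D : Pat} {Γ : Env O} (h : UltPat v D Γ) :
    UltPat (v.ren ρ) D (Env.ren ρ Γ) where
  nodup := h.nodup
  dom i := by rw [Env.mem_ren, h.dom]
  isFun i T T' hi := by
    obtain ⟨w, hw, hf⟩ := h.isFun i T T' hi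
    exact ⟨w.ren ρ, by simp [Env.lookup_ren, hw], hf.ren ρ⟩
  fill := by rw [Pat.fill_ren, h.fill]

/-- Opponent values are typed in the empty store typing, so they contain no free location. This is
why labels need no renaming. -/
theorem OppVal.ren_eq_self (ρ : ℕ ↪ ℕ) {T : Ty} {u : Exp O} (h : OppVal T u) : u.ren ρ = u := by
  obtain ⟨D, as, -, -, -, h⟩ := h
  exact h.ren_eq_self (by simp)

theorem FunRed.ren (ρ : ℕ ↪ ℕ) {v u e : Exp O} (h : FunRed v u e) :
    FunRed (v.ren ρ) (u.ren ρ) (e.ren ρ) := by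
  cases h with
  | name a => simp only [Exp.ren]; exact .name _ _
  | lam T T' e =>
    simp only [Exp.ren, Exp.ren_inst, List.map_cons, List.map_nil]
    exact .lam _ _ _ _

theorem RedBase.ren (ρ : ℕ ↪ ℕ) {s s' : Store O} {e e' : Exp O} (h : RedBase s e s' e') :
    RedBase (Store.ren ρ s) (e.ren ρ) (Store.ren ρ s') (e'.ren ρ) := by
  cases h with
  | op o cs w h =>
    have : (cs.map Exp.const).map (Exp.ren ρ) = cs.map (Exp.const (O := O)) := by
      simp [Function.comp_def, Exp.ren]
    simp only [Exp.ren, Exp.rens_eq_map, this]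
    exact .op _ _ _ _ h
  | beta T₁ T₁' e v hv =>
    simp only [Exp.ren, Exp.ren_inst, List.map_cons, List.map_nil]
    exact .beta _ _ _ _ _ (hv.ren ρ)
  | letIn vs e hv =>
    simp only [Exp.ren, Exp.ren_inst, Exp.rens_eq_map]
    have := RedBase.letIn (Store.ren ρ s) (vs.map (Exp.ren ρ)) (e.ren ρ) (by
      intro v hm
      obtain ⟨w, hw, rfl⟩ := List.mem_map.1 hm
      exact (hv w hw).ren ρ)
    simpa using this
  | new l v e hv hl =>
    simp only [Exp.ren, Exp.ren_openLoc, Store.ren, mapFin_insert]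
    refine .new _ _ _ _ (hv.ren ρ) ?_
    rw [mem_mapFin]
    rintro ⟨l', h', he⟩
    exact hl (ρ.injective he ▸ h')
  | deref l _ h =>
    simp only [Exp.ren, LRef.ren]
    exact .deref _ _ _ (by rw [Store.ren, lookup_mapFin, h, Option.map_some])
  | assign l v hv =>
    simp only [Exp.ren, LRef.ren, Store.ren, mapFin_insert]
    exact .assign _ _ _ (hv.ren ρ)
  | iteTrue e₂ => simp only [Exp.ren]; exact .iteTrue _ _ _
  | iteFalse e₁ => simp only [Exp.ren]; exact .iteFalse _ _ _

theorem Red.ren (ρ : ℕ ↪ ℕ) {s s' : Store O} {e e' : Exp O} (h : Red s e s' e') :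
    Red (Store.ren ρ s) (e.ren ρ) (Store.ren ρ s') (e'.ren ρ) := by
  cases h with | ctx E hE _ _ e e' h =>
  rw [ECtx.ren_fill, ECtx.ren_fill]
  exact .ctx _ (hE.ren ρ) _ _ _ _ (h.ren ρ)

theorem StoreTyping.ren (ρ : ℕ ↪ ℕ) {s : Store O} {S : ℕ → Option Ty} (h : StoreTyping s S) :
    StoreTyping (Store.ren ρ s) (Function.extend ρ S fun _ => none) where
  dom l := by
    by_cases hl : ∃ l', ρ l' = l
    · obtain ⟨l, rfl⟩ := hl
      rw [ρ.injective.extend_apply, h.dom, Store.ren, mem_mapFin]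
      simp [ρ.injective.eq_iff]
    · rw [Function.extend_apply' _ _ _ hl, Store.ren, mem_mapFin]
      simp only [reduceCtorEq, exists_false, false_iff]
      rintro ⟨l', -, he⟩
      exact hl ⟨l', he⟩
  typed l v T hv hT := by
    obtain ⟨l, v, hl, rfl, rfl⟩ := lookup_mapFin_eq_some.1 hv
    rw [ρ.injective.extend_apply] at hT
    obtain ⟨h₁, h₂⟩ := h.typed l v T hl hT
    exact ⟨h₁.ren ρ, h₂.ren fun l T h => by rw [ρ.injective.extend_apply, h]⟩

/-- Rename the locations of a frame. -/
def Frame.ren (ρ : ℕ ↪ ℕ) (F : Frame O) : Frame O := ⟨F.holeTy, F.ctx.ren ρ⟩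

/-- Rename the locations of a configuration. -/
def Conf.ren (ρ : ℕ ↪ ℕ) : Conf O → Conf O
  | .bot => .bot
  | .mk A Γ K s e => .mk A (Env.ren ρ Γ) (K.map (Frame.ren ρ)) (Store.ren ρ s) (e.map (Exp.ren ρ))

-- Equivariance of strong and weak transitions under renaming of locations.

theorem Trans.ren (ρ : ℕ ↪ ℕ) {C C' : Conf O} {η : Label O} (h : Trans C η C') :
    Trans (C.ren ρ) η (C'.ren ρ) := by
  cases h with
  | propApp A Γ Γ' K s E a v D hE hv hD hΓ =>
    simp only [Conf.ren, Option.map_some, ECtx.ren_fill, Exp.ren, Env.ren, mapFin_union]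
    exact .propApp _ _ _ _ _ _ _ _ _ (hE.ren ρ) (hv.ren ρ) (hD.ren ρ) (mapFin_disjoint _ _ hΓ)
  | propRet A Γ Γ' K s v D hv hD hΓ =>
    simp only [Conf.ren, Option.map_some, Env.ren, mapFin_union]
    exact .propRet _ _ _ _ _ _ _ (hv.ren ρ) (hD.ren ρ) (mapFin_disjoint _ _ hΓ)
  | opApp A Γ K s S i v u e T T' hi hS hT hu hA he =>
    refine .opApp _ _ _ _ _ i (v.ren ρ) u (e.ren ρ) T T' (by rw [Env.lookup_ren, hi]; rfl)
      (hS.ren ρ) (hT.ren fun l T h => by rw [ρ.injective.extend_apply, h]) hu hA ?_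
    simpa [hu.ren_eq_self] using he.ren ρ
  | opRet A Γ K s T E u hu hA =>
    simp only [Conf.ren, Option.map_some, ECtx.ren_fill, hu.ren_eq_self]
    exact .opRet _ _ _ _ _ _ _ hu hA
  | tau A Γ K s s' e e' h => exact .tau _ _ _ _ _ _ _ (h.ren ρ)
  | response C η h => exact .response _ _ h
  | term A Γ s => exact .term _ _ _

theorem TauStar.ren (ρ : ℕ ↪ ℕ) {C C' : Conf O} (h : TauStar C C') :
    TauStar (C.ren ρ) (C'.ren ρ) :=
  Relation.ReflTransGen.lift (Conf.ren ρ) (fun _ _ (h : Trans _ .tau _) => h.ren ρ) _ _ h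

theorem WTrans.ren (ρ : ℕ ↪ ℕ) {C C' : Conf O} {η : Label O} (h : WTrans C η C') :
    WTrans (C.ren ρ) η (C'.ren ρ) := by
  obtain ⟨rfl, h⟩ | ⟨hη, C₁, C₂, h₁, h₂, h₃⟩ := h
  · exact .inl ⟨rfl, h.ren ρ⟩
  · exact .inr ⟨hη, _, _, h₁.ren ρ, h₂.ren ρ, h₃.ren ρ⟩

/-- A renaming that fixes the locations of the store fixes a well-formed configuration. -/
theorem WellFormed.ren_eq_self {ρ : ℕ ↪ ℕ} {A : Set Name} {Γ : Env O} {K : List (Frame O)}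
    {s : Store O} {e : Option (Exp O)} (h : WellFormed A Γ K s e) (hρ : ∀ l ∈ s, ρ l = l) :
    Conf.ren ρ (.mk A Γ K s e) = .mk A Γ K s e := by
  obtain ⟨-, -, -, -, -, S, hS, hΓ, hK, he⟩ := h
  have hρ' : ∀ l T, S l = some T → ρ l = l := fun l T h => hρ l ((hS.dom l).1 ⟨T, h⟩)
  have h₁ : Env.ren ρ Γ = Γ := mapFin_eq_self fun i v hi =>
    ⟨rfl, (hΓ i v hi).2.elim fun T hT => hT.ren_eq_self hρ'⟩
  have h₂ : Store.ren ρ s = s := mapFin_eq_self fun l v hl => by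
    have hm := Finmap.mem_of_lookup_eq_some hl
    obtain ⟨T, hT⟩ := (hS.dom l).2 hm
    exact ⟨hρ l hm, (hS.typed l v T hl hT).2.ren_eq_self hρ'⟩
  have h₃ : K.map (Frame.ren ρ) = K := by
    refine (List.map_congr_left fun F hF => ?_).trans (List.map_id K)
    obtain ⟨-, T', hF⟩ := hK F hF
    -- Any expression of the hole type would do; this one is typable whatever the store typing.
    have := hF (.app (.name ⟨0, .base .unit, F.holeTy⟩) (.const .unit))
      (.app _ _ _ _ (.name _) (.const .unit))
    simp only [Frame.ren, id, F.ctx.ren_eq_self (this.ren_eq_self hρ')]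
  have h₄ : e.map (Exp.ren ρ) = e := by
    cases e with
    | none => rfl
    | some e =>
      obtain ⟨T, hT⟩ := he e rfl
      rw [Option.map_some, hT.ren_eq_self hρ']
  simp only [Conf.ren, h₁, h₂, h₃, h₄]

/-! ### Components of configurations and labels -/

/-- Opponent configurations. -/
def Conf.IsOpp : Conf O → Prop
  | .mk _ _ _ _ none => True
  | _ => False

/-- Well-formed configurations other than `⊥`. -/
def Conf.WF : Conf O → Prop
  | .bot => False
  | .mk A Γ K s e => WellFormed A Γ K s e

/-- The domain of the store of a configuration. -/
def Conf.storeDom : Conf O → Finset ℕ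
  | .bot => ∅
  | .mk _ _ _ s _ => s.keys

/-- The abstract names introduced by a label. -/
def Label.names : Label O → Set Name
  | .oapp _ u => u.names
  | .oret u => u.names
  | _ => ∅

/-- The indices introduced by a label. -/
def Label.holes : Label O → Finset ℕ
  | .papp _ D => (D.holes.map Prod.fst).toFinset
  | .pret D => (D.holes.map Prod.fst).toFinset
  | _ => ∅

/-- The labels of the transitions of opponent configurations. -/
def Label.IsOpp : Label O → Prop
  | .oapp _ _ | .oret _ | .term => True
  | _ => False

theorem UltPat.keys {v : Exp O} {D : Pat} {Γ : Env O} (h : UltPat v D Γ) :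
    Γ.keys = (D.holes.map Prod.fst).toFinset := by
  ext i
  rw [Finmap.mem_keys, h.dom, List.mem_toFinset]

theorem Trans.of_bot {η : Label O} {C : Conf O} (h : Trans .bot η C) : C = .bot ∧ η ≠ .term := by
  cases h with | response _ _ h => exact ⟨rfl, h⟩

theorem Trans.envDom {C C' : Conf O} {η : Label O} (h : Trans C η C') (hC : C' ≠ .bot) :
    C'.envDom = C.envDom ∪ η.holes := by
  cases h with
  | propApp A Γ Γ' K s E a v D hE hv hD hΓ =>
    simp [Conf.envDom, Label.holes, Finmap.keys_union, hD.keys]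
  | propRet A Γ Γ' K s v D hv hD hΓ =>
    simp [Conf.envDom, Label.holes, Finmap.keys_union, hD.keys]
  | response => exact absurd rfl hC
  | term => exact absurd rfl hC
  | _ => simp [Conf.envDom, Label.holes]

theorem Trans.used {C C' : Conf O} {η : Label O} (h : Trans C η C') (hC : C' ≠ .bot) :
    C'.used = C.used ∪ η.names := by
  cases h with
  | response => exact absurd rfl hC
  | term => exact absurd rfl hC
  | _ => simp [Conf.used, Label.names]

theorem Trans.storeDom_subset {C C' : Conf O} {η : Label O} (h : Trans C η C') (hC : C' ≠ .bot) :
    C.storeDom ⊆ C'.storeDom := by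
  cases h with
  | response => exact absurd rfl hC
  | term => exact absurd rfl hC
  | tau A Γ K s s' e e' h =>
    intro l hl
    simp only [Conf.storeDom, Finmap.mem_keys] at hl ⊢
    exact h.mem_store hl
  | _ => simp [Conf.storeDom]

theorem Trans.isOpp_iff {C C' : Conf O} (h : Trans C .tau C') (hC : C' ≠ .bot) :
    C'.IsOpp ↔ C.IsOpp := by
  cases h with
  | response => exact absurd rfl hC
  | tau => simp [Conf.IsOpp]

theorem Trans.label_isOpp {C C' : Conf O} {η : Label O} (h : Trans C η C') (hC : C.IsOpp) :
    C' = .bot ∧ η ≠ .term ∨ η.IsOpp := by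
  cases h with
  | response _ _ h => exact .inl ⟨rfl, h⟩
  | propApp | propRet | tau => simp [Conf.IsOpp] at hC
  | _ => simp [Label.IsOpp]

theorem Trans.isOpp_of_label {C C' : Conf O} {η : Label O} (h : Trans C η C') (hη : η.IsOpp)
    (hC : C' ≠ .bot ∨ η = .term) : C.IsOpp := by
  cases h with
  | response _ _ h => simp_all
  | propApp | propRet | tau => simp [Label.IsOpp] at hη
  | _ => simp [Conf.IsOpp]

theorem Trans.ne_bot {C C' : Conf O} {η : Label O} (h : Trans C η C') (hC : C' ≠ .bot) :
    C ≠ .bot := by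
  rintro rfl
  exact hC h.of_bot.1

/-! ### Weak transitions -/

theorem TauStar.ne_bot {C C' : Conf O} (h : TauStar C C') (hC : C' ≠ .bot) : C ≠ .bot := by
  induction h using Relation.ReflTransGen.head_induction_on with
  | refl => exact hC
  | head h _ ih => exact Trans.ne_bot h ih

/-- The target must differ from `⊥`, since every configuration has a silent transition to `⊥`. -/
theorem TauStar.invariants {C C' : Conf O} (h : TauStar C C') (hC : C' ≠ .bot) :
    C'.envDom = C.envDom ∧ C'.used = C.used ∧ C.storeDom ⊆ C'.storeDom ∧
      (C'.IsOpp ↔ C.IsOpp) := by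
  induction h using Relation.ReflTransGen.head_induction_on with
  | refl => simp
  | @head C C₁ h h' ih =>
    have h : Trans C .tau C₁ := h
    have hC₁ := TauStar.ne_bot h' hC
    obtain ⟨h₁, h₂, h₃, h₄⟩ := ih
    refine ⟨?_, ?_, (h.storeDom_subset hC₁).trans h₃, h₄.trans (h.isOpp_iff hC₁)⟩
    · simpa [Label.holes, h.envDom hC₁] using h₁
    · simpa [Label.names, h.used hC₁] using h₂

theorem TauStar.of_bot {C : Conf O} (h : TauStar .bot C) : C = .bot := by
  by_contra hC
  exact h.ne_bot hC rfl

theorem WTrans.of_bot {C : Conf O} {η : Label O} (h : WTrans .bot η C) :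
    C = .bot ∧ η ≠ .term := by
  obtain ⟨rfl, h⟩ | ⟨hη, C₁, C₂, h₁, h₂, h₃⟩ := h
  · exact ⟨h.of_bot, by simp⟩
  · obtain rfl := h₁.of_bot
    obtain ⟨rfl, h⟩ := h₂.of_bot
    exact ⟨h₃.of_bot, h⟩

theorem WTrans.response (C : Conf O) {η : Label O} (hη : η ≠ .term) : WTrans C η .bot := by
  by_cases h : η = .tau
  · subst h
    exact .inl ⟨rfl, .single (.response C .tau hη)⟩
  · exact .inr ⟨h, C, .bot, .refl, .response C η hη, .refl⟩

theorem Trans.weak {C C' : Conf O} {η : Label O} (h : Trans C η C') : WTrans C η C' := by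
  by_cases hη : η = .tau
  · subst hη
    exact .inl ⟨rfl, .single h⟩
  · exact .inr ⟨hη, C, C', .refl, h, .refl⟩

/-- The label alone determines the growth of the environment domain and of the name set, so two
configurations moving along the same label preserve the side conditions of `utSep`. -/
theorem WTrans.invariants {C C' : Conf O} {η : Label O} (h : WTrans C η C') (hC : C' ≠ .bot) :
    C'.envDom = C.envDom ∪ η.holes ∧ C'.used = C.used ∪ η.names ∧
      C.storeDom ⊆ C'.storeDom := by
  obtain ⟨rfl, h⟩ | ⟨hη, C₁, C₂, h₁, h₂, h₃⟩ := h
  · obtain ⟨h₁, h₂, h₃, -⟩ := h.invariants hC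
    exact ⟨by simpa [Label.holes] using h₁, by simpa [Label.names] using h₂, h₃⟩
  · have hC₂ := h₃.ne_bot hC
    have hC₁ := h₂.ne_bot hC₂
    obtain ⟨a₁, a₂, a₃, -⟩ := h₁.invariants hC₁
    obtain ⟨b₁, b₂, b₃, -⟩ := h₃.invariants hC
    exact ⟨by rw [b₁, h₂.envDom hC₂, a₁], by rw [b₂, h₂.used hC₂, a₂],
      (a₃.trans (h₂.storeDom_subset hC₂)).trans b₃⟩

theorem WTrans.isOpp_of_label {C C' : Conf O} {η : Label O} (h : WTrans C η C') (hη : η.IsOpp)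
    (hC : C' ≠ .bot ∨ η = .term) : C.IsOpp := by
  obtain ⟨rfl, h⟩ | ⟨-, C₁, C₂, h₁, h₂, h₃⟩ := h
  · simp [Label.IsOpp] at hη
  · have h := h₂.isOpp_of_label hη (hC.imp_left h₃.ne_bot)
    have hC₁ : C₁ ≠ .bot := by
      rintro rfl
      simp [Conf.IsOpp] at h
    exact (h₁.invariants hC₁).2.2.2.1 h

/-! ### Preservation of well-formedness -/

/-- A function value carries its type as an annotation, so its type is the same in every store
typing that types it. This reconciles the store typing chosen by `Trans.opApp` with the one given by
well-formedness. -/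
theorem FunRed.hasTy_arr {v u e : Exp O} (h : FunRed v u e) {S S' : ℕ → Option Ty} {T T' U : Ty}
    (hT : HasTy S [] [] v (.arr T T')) (hU : HasTy S' [] [] v U) :
    HasTy S' [] [] v (.arr T T') := by
  cases h <;> cases hT <;> cases hU
  · exact .name _
  · exact .lam _ _ _ ‹_›

theorem FunRed.hasTy {v u e : Exp O} (h : FunRed v u e) {S : ℕ → Option Ty} {T T' : Ty}
    (hv : HasTy S [] [] v (.arr T T')) (hu : HasTy S [] [] u T) (hval : IsVal u) :
    HasTy S [] [] e T' := by
  cases h with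
  | name a => exact .app _ _ _ _ hv hu
  | lam T₁ T₁' e =>
    have hl := hv
    cases hv with | lam _ _ _ h =>
    refine h.inst (Us := [T, .arr T T']) ?_ (.cons hu (.cons hl .nil)) [] rfl
    simpa using ⟨hval, .lam _ _ _⟩

theorem FunRed.names {v u e : Exp O} (h : FunRed v u e) {A : Set Name} (hv : v.names ⊆ A)
    (hu : u.names ⊆ A) : e.names ⊆ A := by
  cases h with
  | name a =>
    simp only [Exp.names] at hv ⊢
    exact Set.union_subset hv hu
  | lam T₁ T₁' e => exact Exp.names_inst (by simpa using ⟨hu, hv⟩) _ _ (by simpa [Exp.names] using hv)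

theorem lookup_union_cases {s s' : Store O} {l : ℕ} {v : Exp O}
    (h : (s ∪ s').lookup l = some v) : s.lookup l = some v ∨ s'.lookup l = some v := by
  rcases Finmap.mem_lookup_union.1 h with h | h
  · exact .inl h
  · exact .inr h.2

theorem Trans.wf {C C' : Conf O} {η : Label O} (h : Trans C η C') (hC' : C' ≠ .bot)
    (hC : C.WF) : C'.WF := by
  cases h with
  | propApp A Γ Γ' K s E a v D hE hv hD hΓ =>
    obtain ⟨h₁, h₂, h₃, h₄, h₅, S, hS, h₆, h₇, h₈⟩ := hC
    obtain ⟨T, hT⟩ := h₈ _ rfl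
    obtain ⟨U, hU, hfill⟩ := E.hasTy_fill hT
    cases hU with | app _ _ T₁ _ ha hvT =>
    cases ha
    have hn := (E.names_fill_subset _).1 (h₅ _ rfl)
    simp only [Exp.names, Set.union_subset_iff] at hn
    refine ⟨h₁, fun i w hi => ?_, ?_, h₄, by simp, S, hS, fun i w hi => ?_, ?_, by simp⟩
    · rcases lookup_union_cases hi with hi | hi
      · exact h₂ i w hi
      · exact (hD.lookup hvT hn.2.2 hi).2
    · simpa using ⟨hn.1, h₃⟩
    · rcases lookup_union_cases hi with hi | hi
      · exact h₆ i w hi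
      · exact (hD.lookup hvT hn.2.2 hi).1
    · simp only [List.mem_cons, forall_eq_or_imp]
      exact ⟨⟨hE, T, fun e₀ h => hfill S e₀ (fun _ _ h => h) h⟩, h₇⟩
  | propRet A Γ Γ' K s v D hv hD hΓ =>
    obtain ⟨h₁, h₂, h₃, h₄, h₅, S, hS, h₆, h₇, h₈⟩ := hC
    obtain ⟨T, hT⟩ := h₈ _ rfl
    refine ⟨h₁, fun i w hi => ?_, h₃, h₄, by simp, S, hS, fun i w hi => ?_, h₇, by simp⟩
    · rcases lookup_union_cases hi with hi | hi
      · exact h₂ i w hi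
      · exact (hD.lookup hT (h₅ _ rfl) hi).2
    · rcases lookup_union_cases hi with hi | hi
      · exact h₆ i w hi
      · exact (hD.lookup hT (h₅ _ rfl) hi).1
  | opApp A Γ K s S' i v u e T T' hi hS' hT hu hA he =>
    obtain ⟨h₁, h₂, h₃, h₄, -, S, hS, h₆, h₇, -⟩ := hC
    have hsub : A ⊆ A ∪ u.names := Set.subset_union_left
    refine ⟨h₁.union u.finite_names, fun i w hi => (h₂ i w hi).trans hsub,
      fun F hF => (h₃ F hF).trans hsub, fun l w hl => (h₄ l w hl).trans hsub, ?_,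
      S, hS, h₆, h₇, ?_⟩
    · rintro _ ⟨⟩
      exact he.names ((h₂ i v hi).trans hsub) Set.subset_union_right
    · rintro _ ⟨⟩
      obtain ⟨-, U, hU⟩ := h₆ i v hi
      exact ⟨T', he.hasTy (he.hasTy_arr hT hU) (hu.hasTy S) hu.isVal⟩
  | opRet A Γ K s T E u hu hA =>
    obtain ⟨h₁, h₂, h₃, h₄, -, S, hS, h₆, h₇, -⟩ := hC
    have hsub : A ⊆ A ∪ u.names := Set.subset_union_left
    simp only [List.mem_cons, forall_eq_or_imp] at h₃ h₇
    refine ⟨h₁.union u.finite_names, fun i w hi => (h₂ i w hi).trans hsub,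
      fun F hF => (h₃.2 F hF).trans hsub, fun l w hl => (h₄ l w hl).trans hsub, ?_,
      S, hS, h₆, h₇.2, ?_⟩
    · rintro _ ⟨⟩
      exact (E.names_fill_subset _).2 ⟨h₃.1.trans hsub, Set.subset_union_right⟩
    · rintro _ ⟨⟩
      obtain ⟨⟨-, U, hU⟩, -⟩ := h₇
      exact ⟨U, hU u (hu.hasTy S)⟩
  | tau A Γ K s s' e e' h =>
    obtain ⟨h₁, h₂, h₃, h₄, h₅, S, hS, h₆, h₇, h₈⟩ := hC
    obtain ⟨T, hT⟩ := h₈ _ rfl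
    obtain ⟨S', hle, hS', he'⟩ := h.preserves hS hT
    obtain ⟨hn₁, hn₂⟩ := h.names h₄ (h₅ _ rfl)
    refine ⟨h₁, h₂, h₃, hn₁, by simpa using hn₂, S', hS', fun i v hi => ?_, fun F hF => ?_, ?_⟩
    · obtain ⟨hv, T, hT⟩ := h₆ i v hi
      exact ⟨hv, T, hT.mono hle⟩
    · obtain ⟨hv, T', hT'⟩ := h₇ F hF
      exact ⟨hv, T', ECtx.hasTy_fill_mono hle hT'⟩
    · rintro _ ⟨⟩
      exact ⟨T, he'⟩
  | response => exact absurd rfl hC'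
  | term => exact absurd rfl hC'

/-! ### Separating conjunctions -/

/-- The other component. -/
def Side.swap : Side → Side
  | .one => .two
  | .two => .one

theorem Interleave.swap {k : List Side} {K₁ K₂ K : List (Frame O)} (h : Interleave k K₁ K₂ K) :
    Interleave (k.map Side.swap) K₂ K₁ K := by
  induction h with
  | nil => exact .nil
  | one k E K₁ K₂ K _ ih => exact .two _ _ _ _ _ ih
  | two k E K₁ K₂ K _ ih => exact .one _ _ _ _ _ ih

theorem SepConj.swap {i : Side} {k : List Side} {C₁ C₂ C : Conf O} (h : SepConj i k C₁ C₂ C) :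
    SepConj i.swap (k.map Side.swap) C₂ C₁ C := by
  cases h with
  | one _ A₁ A₂ Γ₁ Γ₂ K₁ K₂ K s₁ s₂ e h₁ h₂ hΓ hK hs =>
    rw [Set.union_comm, Finmap.union_comm_of_disjoint hΓ, Finmap.union_comm_of_disjoint hs]
    exact .two _ _ _ _ _ _ _ _ _ _ _ h₂ h₁ hΓ.symm hK.swap hs.symm
  | two _ A₁ A₂ Γ₁ Γ₂ K₁ K₂ K s₁ s₂ e h₁ h₂ hΓ hK hs =>
    rw [Set.union_comm, Finmap.union_comm_of_disjoint hΓ, Finmap.union_comm_of_disjoint hs]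
    exact .one _ _ _ _ _ _ _ _ _ _ _ h₂ h₁ hΓ.symm hK.swap hs.symm

/-- When neither component has an expression, either may be taken as the active one, so a move of
the second component can be treated as a move of the first. -/
theorem SepConj.swap_of_isOpp {k : List Side} {C₁ C₂ C : Conf O} (h : SepConj .one k C₁ C₂ C)
    (hC : C₁.IsOpp) : SepConj .one (k.map Side.swap) C₂ C₁ C := by
  cases h with
  | one _ A₁ A₂ Γ₁ Γ₂ K₁ K₂ K s₁ s₂ e h₁ h₂ hΓ hK hs =>
    cases e with
    | some e => simp [Conf.IsOpp] at hC
    | none =>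
      rw [Set.union_comm, Finmap.union_comm_of_disjoint hΓ, Finmap.union_comm_of_disjoint hs]
      exact .one _ _ _ _ _ _ _ _ _ _ _ h₂ h₁ hΓ.symm hK.swap hs.symm

theorem SepConj.wf_left {k : List Side} {C₁ C₂ C : Conf O} (h : SepConj .one k C₁ C₂ C) :
    C₁.WF := by
  cases h with | one _ _ _ _ _ _ _ _ _ _ _ h₁ => exact h₁

/-- The effect of a transition of the first component on the interleaving of the stacks. -/
def StackStep : Label O → List Side → List Side → Prop
  | .papp _ _, k, k' => k' = .one :: k
  | .oret _, k, k' => k = .one :: k'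
  | _, k, k' => k' = k

theorem Finmap.union_right_comm {s₁ s₂ s₃ : Store O} (h : s₂.Disjoint s₃) :
    s₁ ∪ s₂ ∪ s₃ = s₁ ∪ s₃ ∪ s₂ := by
  rw [Finmap.union_assoc, Finmap.union_comm_of_disjoint h, Finmap.union_assoc]

/-- The union is left-biased, but disjointness of the stores makes it extend `S₂` as well. -/
theorem StoreTyping.union {s₁ s₂ : Store O} {S₁ S₂ : ℕ → Option Ty} (h₁ : StoreTyping s₁ S₁)
    (h₂ : StoreTyping s₂ S₂) (hd : s₁.Disjoint s₂) :
    TyLe S₁ (fun l => (S₁ l).or (S₂ l)) ∧ StoreTyping (s₁ ∪ s₂) fun l => (S₁ l).or (S₂ l) := by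
  have le₁ : TyLe S₁ fun l => (S₁ l).or (S₂ l) := fun l T h => by simp [h]
  have le₂ : TyLe S₂ fun l => (S₁ l).or (S₂ l) := fun l T h => by
    have : S₁ l = none := by
      by_contra hne
      exact hd l ((h₁.dom l).1 (Option.ne_none_iff_exists'.1 hne)) ((h₂.dom l).1 ⟨T, h⟩)
    simp [h, this]
  refine ⟨le₁, ⟨fun l => ?_, fun l v T hv hT => ?_⟩⟩
  · rw [Finmap.mem_union, ← h₁.dom, ← h₂.dom]
    simp only [Option.or_eq_some_iff]
    constructor
    · rintro ⟨T, h | h⟩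
      · exact .inl ⟨T, h⟩
      · exact .inr ⟨T, h.2⟩
    · rintro (⟨T, h⟩ | ⟨T, h⟩)
      · exact ⟨T, .inl h⟩
      · exact ⟨T, Option.or_eq_some_iff.1 (le₂ l T h)⟩
  · rcases lookup_union_cases hv with hv | hv
    · obtain ⟨T', hT'⟩ := (h₁.dom l).2 (Finmap.mem_of_lookup_eq_some hv)
      cases (le₁ l T' hT').symm.trans hT
      obtain ⟨a, b⟩ := h₁.typed l v T hv hT'
      exact ⟨a, b.mono le₁⟩
    · obtain ⟨T', hT'⟩ := (h₂.dom l).2 (Finmap.mem_of_lookup_eq_some hv)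
      cases (le₂ l T' hT').symm.trans hT
      obtain ⟨a, b⟩ := h₂.typed l v T hv hT'
      exact ⟨a, b.mono le₂⟩

theorem Finmap.disjoint_iff_keys {s s' : Store O} : s.Disjoint s' ↔ Disjoint s.keys s'.keys := by
  simp [Finset.disjoint_left, Finmap.Disjoint, Finmap.mem_keys]

/-- A transition of the first component yields a transition of the conjunction. -/
theorem SepConj.trans_left {k k' : List Side} {C₁ C₁' C₂ C : Conf O} {η : Label O}
    (hC : SepConj .one k C₁ C₂ C) (h : Trans C₁ η C₁') (hC₁ : C₁' ≠ .bot)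
    (hk : StackStep η k k') (hh : Disjoint η.holes C₂.envDom) (hn : Disjoint η.names C₂.used)
    (hs' : Disjoint C₁'.storeDom C₂.storeDom) :
    ∃ C', Trans C η C' ∧ SepConj .one k' C₁' C₂ C' := by
  have hwf := h.wf hC₁ hC.wf_left
  cases hC with | one _ A₁ A₂ Γ₁ Γ₂ K₁ K₂ K s₁ s₂ e h₁ h₂ hΓ hK hs =>
  simp only [Conf.envDom, Conf.used] at hh hn
  cases h with
  | propApp _ _ Γ' _ _ E a v D hE hv hD hΓ' =>
    obtain rfl : k' = .one :: k := hk
    rw [Label.holes, ← hD.keys, ← Finmap.disjoint_iff_keys] at hh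
    refine ⟨_, .propApp _ _ Γ' _ _ E a v D hE hv hD ?_, ?_⟩
    · exact (Finmap.disjoint_union_left _ _ _).2 ⟨hΓ', hh.symm⟩
    · rw [← Finmap.union_right_comm hh]
      exact .one _ _ _ _ _ _ _ _ _ _ _ hwf h₂ ((Finmap.disjoint_union_left _ _ _).2 ⟨hΓ, hh⟩)
        (.one _ _ _ _ _ hK) hs
  | propRet _ _ Γ' _ _ v D hv hD hΓ' =>
    obtain rfl : k' = k := hk
    rw [Label.holes, ← hD.keys, ← Finmap.disjoint_iff_keys] at hh
    refine ⟨_, .propRet _ _ Γ' _ _ v D hv hD ?_, ?_⟩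
    · exact (Finmap.disjoint_union_left _ _ _).2 ⟨hΓ', hh.symm⟩
    · rw [← Finmap.union_right_comm hh]
      exact .one _ _ _ _ _ _ _ _ _ _ _ hwf h₂ ((Finmap.disjoint_union_left _ _ _).2 ⟨hΓ, hh⟩)
        hK hs
  | opApp _ _ _ _ S i v u e T T' hi hS hT hu hA he =>
    obtain rfl : k' = k := hk
    obtain ⟨-, -, -, -, -, S₂, hS₂, -⟩ := id h₂
    obtain ⟨hle, hS'⟩ := hS.union hS₂ hs
    refine ⟨_, .opApp _ _ _ _ _ i v u e T T' ?_ hS' (hT.mono hle) hu ?_ he, ?_⟩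
    · rw [Finmap.lookup_union_left (Finmap.mem_of_lookup_eq_some hi), hi]
    · exact Set.disjoint_union_left.2 ⟨hA, hn.symm⟩
    · rw [Set.union_right_comm]
      exact .one _ _ _ _ _ _ _ _ _ _ _ hwf h₂ hΓ hK hs
  | opRet _ _ K₁ _ T E u hu hA =>
    obtain rfl : k = .one :: k' := hk
    cases hK with | one _ _ _ _ K hK =>
    refine ⟨_, .opRet _ _ _ _ T E u hu ?_, ?_⟩
    · exact Set.disjoint_union_left.2 ⟨hA, hn.symm⟩
    · rw [Set.union_right_comm]
      exact .one _ _ _ _ _ _ _ _ _ _ _ hwf h₂ hΓ hK hs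
  | tau _ _ _ _ s' e e' h =>
    obtain rfl : k' = k := hk
    rw [Conf.storeDom, Conf.storeDom, ← Finmap.disjoint_iff_keys] at hs'
    exact ⟨_, .tau _ _ _ _ _ _ _ (h.frame hs'), .one _ _ _ _ _ _ _ _ _ _ _ hwf h₂ hΓ hK hs'⟩
  | response => exact absurd rfl hC₁
  | term => exact absurd rfl hC₁

theorem SepConj.envDom_disjoint {i : Side} {k : List Side} {C₁ C₂ C : Conf O}
    (h : SepConj i k C₁ C₂ C) : Disjoint C₁.envDom C₂.envDom := by
  cases h <;> exact Finmap.disjoint_iff_keys.1 ‹_›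

theorem SepConj.storeDom_disjoint {i : Side} {k : List Side} {C₁ C₂ C : Conf O}
    (h : SepConj i k C₁ C₂ C) : Disjoint C₁.storeDom C₂.storeDom := by
  cases h <;> exact Finmap.disjoint_iff_keys.1 ‹_›

theorem SepConj.left_ne_bot {i : Side} {k : List Side} {C₁ C₂ C : Conf O}
    (h : SepConj i k C₁ C₂ C) : C₁ ≠ .bot := by
  cases h <;> simp

/-- `D` is reached from the conjunction of `C₁` and `C₂` along `k` by a transition of `C₁`. -/
def LeftMove (k : List Side) (C₁ C₂ : Conf O) (η : Label O) (D : Conf O) : Prop :=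
  ∃ C₁' k', Trans C₁ η C₁' ∧ StackStep η k k' ∧ SepConj .one k' C₁' C₂ D ∧
    Disjoint η.names C₂.used

/-- A move of a conjunction whose environment provides the opponent's function on the left. -/
theorem leftMove_opApp {k : List Side} {A₁ A₂ : Set Name} {Γ₁ Γ₂ : Env O}
    {K₁ K₂ K : List (Frame O)} {s₁ s₂ : Store O} {S : ℕ → Option Ty} {i : ℕ} {v u e : Exp O}
    {T T' : Ty} (h₁ : WellFormed A₁ Γ₁ K₁ s₁ none) (h₂ : WellFormed A₂ Γ₂ K₂ s₂ none)
    (hΓ : Γ₁.Disjoint Γ₂) (hK : Interleave k K₁ K₂ K) (hs : s₁.Disjoint s₂)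
    (hi : Γ₁.lookup i = some v) (hT : HasTy S [] [] v (.arr T T')) (hu : OppVal T u)
    (hA₁ : Disjoint A₁ u.names) (hA₂ : Disjoint A₂ u.names) (he : FunRed v u e) :
    LeftMove k (.mk A₁ Γ₁ K₁ s₁ none) (.mk A₂ Γ₂ K₂ s₂ none) (.oapp i u)
      (.mk (A₁ ∪ A₂ ∪ u.names) (Γ₁ ∪ Γ₂) K (s₁ ∪ s₂) (some e)) := by
  obtain ⟨-, -, -, -, -, S₁, hS₁, hΓ₁, -, -⟩ := id h₁
  obtain ⟨-, U, hU⟩ := hΓ₁ i v hi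
  have ht : Trans (.mk A₁ Γ₁ K₁ s₁ none) (.oapp i u) _ :=
    .opApp _ _ _ _ S₁ i v u e T T' hi hS₁ (he.hasTy_arr hT hU) hu hA₁ he
  refine ⟨_, k, ht, rfl, ?_, hA₂.symm⟩
  rw [Set.union_right_comm]
  exact .one _ _ _ _ _ _ _ _ _ _ _ (ht.wf (by simp) h₁) h₂ hΓ hK hs

theorem leftMove_opRet {k : List Side} {A₁ A₂ : Set Name} {Γ₁ Γ₂ : Env O}
    {K₁ K₂ K : List (Frame O)} {s₁ s₂ : Store O} {E : ECtx O} {u : Exp O} {T : Ty}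
    (h₁ : WellFormed A₁ Γ₁ (⟨T, E⟩ :: K₁) s₁ none) (h₂ : WellFormed A₂ Γ₂ K₂ s₂ none)
    (hΓ : Γ₁.Disjoint Γ₂) (hK : Interleave k K₁ K₂ K) (hs : s₁.Disjoint s₂) (hu : OppVal T u)
    (hA₁ : Disjoint A₁ u.names) (hA₂ : Disjoint A₂ u.names) :
    LeftMove (.one :: k) (.mk A₁ Γ₁ (⟨T, E⟩ :: K₁) s₁ none) (.mk A₂ Γ₂ K₂ s₂ none) (.oret u)
      (.mk (A₁ ∪ A₂ ∪ u.names) (Γ₁ ∪ Γ₂) K (s₁ ∪ s₂) (some (E.fill u))) := by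
  have ht : Trans (.mk A₁ Γ₁ (⟨T, E⟩ :: K₁) s₁ none) (.oret u) _ := .opRet _ _ _ _ T E u hu hA₁
  refine ⟨_, k, ht, rfl, ?_, hA₂.symm⟩
  rw [Set.union_right_comm]
  exact .one _ _ _ _ _ _ _ _ _ _ _ (ht.wf (by simp) h₁) h₂ hΓ hK hs

/-- The transitions of a conjunction are responses, terminations, or come from one of its
components. -/
theorem SepConj.trans_cases {k : List Side} {C₁ C₂ C D : Conf O} {η : Label O}
    (hC : SepConj .one k C₁ C₂ C) (h : Trans C η D) :
    (D = .bot ∧ η ≠ .term) ∨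
    (D = .bot ∧ η = .term ∧ Trans C₁ .term .bot ∧ Trans C₂ .term .bot ∧ k = [] ∧ C₁.IsOpp) ∨
    LeftMove k C₁ C₂ η D ∨ (C₁.IsOpp ∧ LeftMove (k.map Side.swap) C₂ C₁ η D) := by
  cases hC with | one _ A₁ A₂ Γ₁ Γ₂ K₁ K₂ K s₁ s₂ e h₁ h₂ hΓ hK hs =>
  cases h with
  | propApp _ _ Γ' _ _ E a v D hE hv hD hΓ' =>
    obtain ⟨hd₁, hd₂⟩ := (Finmap.disjoint_union_left _ _ _).1 hΓ'
    have ht : Trans (.mk A₁ Γ₁ K₁ s₁ (some (E.fill (.app (.name a) v)))) (.papp a D) _ :=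
      .propApp _ _ Γ' _ _ E a v D hE hv hD hd₁
    refine .inr (.inr (.inl ⟨_, .one :: k, ht, rfl, ?_, by simp [Label.names]⟩))
    rw [Finmap.union_right_comm hd₂]
    exact .one _ _ _ _ _ _ _ _ _ _ _ (ht.wf (by simp) h₁) h₂
      ((Finmap.disjoint_union_left _ _ _).2 ⟨hΓ, hd₂.symm⟩) (.one _ _ _ _ _ hK) hs
  | propRet _ _ Γ' _ _ v D hv hD hΓ' =>
    obtain ⟨hd₁, hd₂⟩ := (Finmap.disjoint_union_left _ _ _).1 hΓ'
    have ht : Trans (.mk A₁ Γ₁ K₁ s₁ (some v)) (.pret D) _ :=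
      .propRet _ _ Γ' _ _ v D hv hD hd₁
    refine .inr (.inr (.inl ⟨_, k, ht, rfl, ?_, by simp [Label.names]⟩))
    rw [Finmap.union_right_comm hd₂]
    exact .one _ _ _ _ _ _ _ _ _ _ _ (ht.wf (by simp) h₁) h₂
      ((Finmap.disjoint_union_left _ _ _).2 ⟨hΓ, hd₂.symm⟩) hK hs
  | opApp _ _ _ _ S i v u e T T' hi hS hT hu hA he =>
    obtain ⟨hA₁, hA₂⟩ := Set.disjoint_union_left.1 hA
    refine .inr (.inr ?_)
    rcases lookup_union_cases hi with hi | hi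
    · exact .inl (leftMove_opApp h₁ h₂ hΓ hK hs hi hT hu hA₁ hA₂ he)
    · refine .inr ⟨trivial, ?_⟩
      rw [Set.union_comm A₁, Finmap.union_comm_of_disjoint hΓ, Finmap.union_comm_of_disjoint hs]
      exact leftMove_opApp h₂ h₁ hΓ.symm hK.swap hs.symm hi hT hu hA₂ hA₁ he
  | opRet _ _ K' _ T E u hu hA =>
    obtain ⟨hA₁, hA₂⟩ := Set.disjoint_union_left.1 hA
    refine .inr (.inr ?_)
    cases hK with
    | one k _ K₁ _ _ hK => exact .inl (leftMove_opRet h₁ h₂ hΓ hK hs hu hA₁ hA₂)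
    | two k _ _ K₂ _ hK =>
      refine .inr ⟨trivial, ?_⟩
      rw [Set.union_comm A₁, Finmap.union_comm_of_disjoint hΓ, Finmap.union_comm_of_disjoint hs]
      exact leftMove_opRet h₂ h₁ hΓ.symm hK.swap hs.symm hu hA₂ hA₁
  | tau _ _ _ _ s' e e' h =>
    obtain ⟨-, -, -, -, -, S, hS, -, -, he⟩ := id h₁
    obtain ⟨T, hT⟩ := he _ rfl
    -- The running expression is typed by the first store alone, so its step leaves the second store
    -- untouched.
    obtain ⟨s₁', hred, rfl, hs'⟩ := h.unframe hs hS hT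
    have ht : Trans (.mk A₁ Γ₁ K₁ s₁ (some e)) .tau _ := .tau _ _ _ _ _ _ _ hred
    exact .inr (.inr (.inl ⟨_, k, ht, rfl,
      .one _ _ _ _ _ _ _ _ _ _ _ (ht.wf (by simp) h₁) h₂ hΓ hK hs', by simp [Label.names]⟩))
  | response _ _ h => exact .inl ⟨rfl, h⟩
  | term _ _ _ =>
    cases hK
    exact .inr (.inl ⟨rfl, rfl, .term _ _ _, .term _ _ _, rfl, trivial⟩)

theorem SepConj.term {C₁ C₂ C : Conf O} (hC : SepConj .one [] C₁ C₂ C) (h : C₁.IsOpp) :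
    Trans C .term .bot := by
  cases hC with | one _ A₁ A₂ Γ₁ Γ₂ K₁ K₂ K s₁ s₂ e h₁ h₂ hΓ hK hs =>
  cases hK
  cases e with
  | none => exact .term _ _ _
  | some e => simp [Conf.IsOpp] at h

-- Framing of weak transitions.

theorem SepConj.tauStar_left {k : List Side} {C₁ C₁' C₂ C : Conf O}
    (hC : SepConj .one k C₁ C₂ C) (h : TauStar C₁ C₁') (hC₁ : C₁' ≠ .bot)
    (hs : Disjoint C₁'.storeDom C₂.storeDom) :
    ∃ C', TauStar C C' ∧ SepConj .one k C₁' C₂ C' := by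
  induction h using Relation.ReflTransGen.head_induction_on generalizing C with
  | refl => exact ⟨C, .refl, hC⟩
  | head h h' ih =>
    have hne := TauStar.ne_bot h' hC₁
    obtain ⟨C', ht, hC'⟩ := hC.trans_left h hne (k' := k) rfl (by simp [Label.holes])
      (by simp [Label.names]) (hs.mono_left (TauStar.invariants h' hC₁).2.2.1)
    obtain ⟨C'', ht', hC''⟩ := ih hC'
    exact ⟨C'', .head ht ht', hC''⟩

theorem SepConj.wTrans_left {k k' : List Side} {C₁ C₁' C₂ C : Conf O} {η : Label O}
    (hC : SepConj .one k C₁ C₂ C) (h : WTrans C₁ η C₁') (hC₁ : C₁' ≠ .bot)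
    (hk : StackStep η k k') (hh : Disjoint η.holes C₂.envDom) (hn : Disjoint η.names C₂.used)
    (hs : Disjoint C₁'.storeDom C₂.storeDom) :
    ∃ C', WTrans C η C' ∧ SepConj .one k' C₁' C₂ C' := by
  obtain ⟨rfl, h⟩ | ⟨hη, D₁, D₂, h₁, h₂, h₃⟩ := h
  · obtain rfl : k' = k := hk
    obtain ⟨C', h', hC'⟩ := hC.tauStar_left h hC₁ hs
    exact ⟨C', .inl ⟨rfl, h'⟩, hC'⟩
  · have hD₂ := h₃.ne_bot hC₁
    -- Store domains only grow, so disjointness at the end gives disjointness at every intermediate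
    -- point.
    have hs₂ := hs.mono_left (h₃.invariants hC₁).2.2.1
    obtain ⟨E₁, t₁, hE₁⟩ := hC.tauStar_left h₁ (h₂.ne_bot hD₂)
      (hs₂.mono_left (h₂.storeDom_subset hD₂))
    obtain ⟨E₂, t₂, hE₂⟩ := hE₁.trans_left h₂ hD₂ hk hh hn hs₂
    obtain ⟨C', t₃, hC'⟩ := hE₂.tauStar_left h₃ hC₁ hs
    exact ⟨C', .inr ⟨hη, E₁, E₂, t₁, t₂, t₃⟩, hC'⟩

/-- For finite `s` and `s'`, there is a renaming that fixes `s` and moves all other locations out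
of `s'`. -/
theorem exists_renaming (s s' : Finset ℕ) :
    ∃ ρ : ℕ ↪ ℕ, (∀ l ∈ s, ρ l = l) ∧ ∀ l ∉ s, ρ l ∉ s' := by
  obtain ⟨N, hN⟩ := (s ∪ s').exists_nat_subset_range
  have hlt : ∀ l, l ∈ s ∨ l ∈ s' → l < N := fun l hl => by
    simpa using hN (Finset.mem_union.2 hl)
  -- Shifting by a strict bound `N` of both sets sends the locations outside `s` beyond `s` and
  -- `s'`.
  have hinj : Function.Injective fun l => if l ∈ s then l else l + N := by
    intro l l' h
    have := hlt l
    have := hlt l'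
    grind
  refine ⟨⟨_, hinj⟩, fun l hl => ?_, fun l hl h => ?_⟩
  · simp [hl]
  · have := hlt _ (.inr h)
    simp [hl] at this

theorem Conf.envDom_ren (ρ : ℕ ↪ ℕ) (C : Conf O) : (C.ren ρ).envDom = C.envDom := by
  cases C with
  | bot => rfl
  | mk => ext i; simp [Conf.ren, Conf.envDom, Finmap.mem_keys, Env.mem_ren]

theorem Conf.used_ren (ρ : ℕ ↪ ℕ) (C : Conf O) : (C.ren ρ).used = C.used := by
  cases C <;> rfl

theorem Conf.mem_storeDom_ren {ρ : ℕ ↪ ℕ} {C : Conf O} {l : ℕ} :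
    l ∈ (C.ren ρ).storeDom ↔ ∃ l' ∈ C.storeDom, ρ l' = l := by
  cases C with
  | bot => simp [Conf.ren, Conf.storeDom]
  | mk => simp [Conf.ren, Conf.storeDom, Finmap.mem_keys, Store.ren, mem_mapFin]

/-- A weak transition of the first component yields one of the conjunction, if the locations that
it allocates are renamed suitably. -/
theorem SepConj.wTrans_left_ren {k k' : List Side} {C₁ C₁' C₂ C : Conf O} {η : Label O}
    (hC : SepConj .one k C₁ C₂ C) (h : WTrans C₁ η C₁') (hC₁ : C₁' ≠ .bot)
    (hk : StackStep η k k') (hh : Disjoint η.holes C₂.envDom) (hn : Disjoint η.names C₂.used) :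
    ∃ ρ C', WTrans C η C' ∧ SepConj .one k' (C₁'.ren ρ) C₂ C' := by
  obtain ⟨ρ, hρ, hρ'⟩ := exists_renaming C₁.storeDom C₂.storeDom
  have hfix : C₁.ren ρ = C₁ := by
    have := hC.wf_left
    cases C₁ with
    | bot => rfl
    | mk => exact WellFormed.ren_eq_self this fun l hl => hρ l (Finmap.mem_keys.2 hl)
  have hren := h.ren ρ
  rw [hfix] at hren
  refine ⟨ρ, hC.wTrans_left hren ?_ hk hh hn ?_⟩
  · cases C₁' <;> simp_all [Conf.ren]
  · rw [Finset.disjoint_left]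
    intro l hl
    obtain ⟨l', -, rfl⟩ := Conf.mem_storeDom_ren.1 hl
    by_cases hl' : l' ∈ C₁.storeDom
    · rw [hρ l' hl']
      exact Finset.disjoint_left.1 hC.storeDom_disjoint hl'
    · exact hρ' l' hl'

/-! ### The companion and the tower -/

theorem WP_mono : Monotone (WP (O := O)) := by
  intro R R' hR C₁ C₂ h η C₁' ht
  obtain ⟨C₂', hw, h'⟩ := h η C₁' ht
  exact ⟨C₂', hw, hR _ _ h'⟩

theorem utSep_mono : Monotone (utSep (O := O)) := by
  intro R R' hR C C' h
  cases h with
  | sep i k C₁ C₂ C₃ C₄ _ _ h₁ h₂ hd₁ hd₂ hA₁ hA₂ hC hC' =>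
    exact .sep i k C₁ C₂ C₃ C₄ _ _ (hR _ _ h₁) (hR _ _ h₂) hd₁ hd₂ hA₁ hA₂ hC hC'
  | botL i k C₁ C₃ C₄ _ h₁ h₂ hC => exact .botL i k C₁ C₃ C₄ _ (hR _ _ h₁) (hR _ _ h₂) hC
  | botR i k C₁ C₂ C₃ _ h₁ h₂ hC => exact .botR i k C₁ C₂ C₃ _ (hR _ _ h₁) (hR _ _ h₂) hC

/-- The tower of `WP`: the least set of relations closed under `WP` and intersections. -/
inductive Tower : CRel O → Prop
  | step (x : CRel O) (h : Tower x) : Tower (WP x)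
  | inf (X : Set (CRel O)) (h : ∀ x ∈ X, Tower x) : Tower (sInf X)

theorem Tower.WP_le {x : CRel O} (h : Tower x) : WP x ≤ x := by
  induction h with
  | step x _ ih => exact WP_mono ih
  | inf X _ ih => exact le_sInf fun x hx => (WP_mono (sInf_le hx)).trans (ih x hx)

/-- Compatibility is exactly what carries closure under `f` from `x` to `WP x`; monotonicity carries
it through intersections. -/
theorem Tower.le_of_compatible {f : CRel O → CRel O} (hf : IsCompatible f) {x : CRel O}
    (h : Tower x) : f x ≤ x := by
  induction h with
  | step x _ ih => exact (hf.2 x).trans (WP_mono ih)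
  | inf X _ ih => exact le_sInf fun x hx => (hf.1 (sInf_le hx)).trans (ih x hx)

/-- The least element of the tower above a relation. -/
def towerClosure (x : CRel O) : CRel O := sInf {y | Tower y ∧ x ≤ y}

theorem tower_towerClosure (x : CRel O) : Tower (towerClosure x) := .inf _ fun _ hy => hy.1

theorem le_towerClosure (x : CRel O) : x ≤ towerClosure x := le_sInf fun _ hy => hy.2

theorem towerClosure_le {x y : CRel O} (hy : Tower y) (h : x ≤ y) : towerClosure x ≤ y :=
  sInf_le ⟨hy, h⟩

theorem towerClosure_compatible : IsCompatible (towerClosure (O := O)) :=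
  ⟨fun _ y h => towerClosure_le (tower_towerClosure y) (h.trans (le_towerClosure y)),
    fun x => towerClosure_le (.step _ (tower_towerClosure x)) (WP_mono (le_towerClosure x))⟩

theorem companion_le_towerClosure (x : CRel O) : companion x ≤ towerClosure x := by
  rintro C C' ⟨f, hf, h⟩
  exact (tower_towerClosure x).le_of_compatible hf _ _ (hf.1 (le_towerClosure x) _ _ h)

/-- The simulation witnessing soundness is the tower closure of `R`: from `R ≤ WP (towerClosure R)`,
whose right-hand side already belongs to the tower, closing the left-hand side preserves the
inclusion. -/
theorem isSoundUpTo_of_le_towerClosure {f : CRel O → CRel O} (hf : ∀ x, f x ≤ towerClosure x) :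
    IsSoundUpTo f := by
  intro R hR C C' h
  refine ⟨towerClosure R, ?_, le_towerClosure R _ _ h⟩
  calc towerClosure R ≤ towerClosure (WP (towerClosure R)) :=
        towerClosure_compatible.1 (hR.trans (WP_mono (hf R)))
    _ ≤ WP (towerClosure R) :=
        towerClosure_le (.step _ (tower_towerClosure R)) le_rfl

theorem omegaIter_le_towerClosure {f : CRel O → CRel O} (hf : ∀ x, f x ≤ towerClosure x)
    (x : CRel O) : omegaIter f x ≤ towerClosure x := by
  rintro C C' ⟨n, h⟩
  suffices f^[n] x ≤ towerClosure x from this _ _ h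
  clear h
  induction n with
  | zero => exact le_towerClosure x
  | succ n ih =>
    rw [Function.iterate_succ_apply']
    exact (hf _).trans (towerClosure_le (tower_towerClosure x) ih)

/-- The constant function with value equality is compatible, since equality is a weak simulation. -/
theorem Tower.refl {x : CRel O} (h : Tower x) (C : Conf O) : x C C := by
  have hc : IsCompatible (O := O) fun _ => Eq := by
    refine ⟨fun _ _ _ => le_rfl, fun _ => ?_⟩
    rintro C _ rfl η C' ht
    exact ⟨C', ht.weak, rfl⟩
  exact h.le_of_compatible hc C C rfl

/-- Composing on the right with a renaming is compatible, by equivariance of weak transitions. -/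
theorem Tower.ren {x : CRel O} (h : Tower x) {C C' : Conf O} (hx : x C C') (ρ : ℕ ↪ ℕ) :
    x C (C'.ren ρ) := by
  have hc : IsCompatible (O := O) fun R C₁ C₂ => ∃ C, R C₁ C ∧ C₂ = C.ren ρ := by
    refine ⟨fun R R' hR C₁ C₂ ⟨C, hC, he⟩ => ⟨C, hR _ _ hC, he⟩, fun R => ?_⟩
    rintro C₁ _ ⟨C, hC, rfl⟩ η C₁' ht
    obtain ⟨C', hw, hR⟩ := hC η C₁' ht
    exact ⟨C'.ren ρ, hw.ren ρ, C', hR, rfl⟩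
  exact h.le_of_compatible hc _ _ ⟨C', hx, rfl⟩

/-! ### Up to separation -/

/-- A configuration below `⊥` is below every configuration. -/
theorem WP_of_bot {x : CRel O} {C : Conf O} (h : WP x C .bot) (C' : Conf O) :
    WP x C C' := by
  intro η D ht
  obtain ⟨D', hw, hD⟩ := h η D ht
  obtain ⟨rfl, hη⟩ := hw.of_bot
  exact ⟨.bot, .response C' hη, hD⟩

/-- An opponent configuration below a proponent one is below `⊥`. -/
theorem WP_bot_of_isOpp {x : CRel O} (hx : Tower x) {C C' : Conf O} (h : WP x C C')
    (hC : C.IsOpp) (hC' : ¬ C'.IsOpp) : WP x C .bot := by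
  intro η D ht
  rcases ht.label_isOpp hC with ⟨rfl, hη⟩ | hη
  · exact ⟨.bot, .response _ hη, hx.refl _⟩
  · obtain ⟨D', hw, hD⟩ := h η D ht
    -- Silent steps that avoid `⊥` never make a proponent configuration an opponent one, so it can
    -- answer an opponent label only by giving up to `⊥`.
    have hnot : ¬(D' ≠ .bot ∨ η = .term) := fun hD' => hC' (hw.isOpp_of_label hη hD')
    rw [not_or, not_not] at hnot
    obtain ⟨rfl, hη'⟩ := hnot
    exact ⟨.bot, .response _ hη', hD⟩

section
variable {x : CRel O} {k : List Side}
  {C₁ C₂ C₃ C₄ C C' D : Conf O} {η : Label O}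

/-- A move of the first component is simulated by the second conjunction. -/
theorem LeftMove.simulated (hm : LeftMove k C₁ C₃ η D) (hx : Tower x) (hsep : utSep x ≤ x)
    (h₁ : WP x C₁ C₂) (h₂ : x C₃ C₄) (hd₁ : C₁.envDom = C₂.envDom) (hd₂ : C₃.envDom = C₄.envDom)
    (hA₁ : C₂.used ⊆ C₁.used) (hA₂ : C₄.used ⊆ C₃.used) (hC' : SepConj .one k C₂ C₄ C') :
    ∃ D', WTrans C' η D' ∧ x D D' := by
  obtain ⟨C₁', k', ht, hk, hD, hn⟩ := hm
  obtain ⟨C₂', hw, hR⟩ := h₁ η C₁' ht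
  have hC₁' := hD.left_ne_bot
  by_cases hC₂' : C₂' = .bot
  · subst hC₂'
    -- An answer `⊥` in the component becomes an answer `⊥` of the conjunction. The label is not
    -- `term`, which would have led `C₁` to `⊥`.
    refine ⟨.bot, .response C' ?_, hsep _ _ (.botL .one k' C₁' C₃ C₄ D hR h₂ hD)⟩
    rintro rfl
    cases ht <;> exact hC₁' rfl
  · have henv : C₁'.envDom = C₂'.envDom := by
      rw [ht.envDom hC₁', (hw.invariants hC₂').1, hd₁]
    -- The new indices belong to the environment of `C₁'`, which is disjoint from that of `C₃`, and
    -- `C₄` has the same domain as `C₃`.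
    have hh : Disjoint η.holes C₄.envDom := by
      rw [← hd₂]
      refine hD.envDom_disjoint.mono_left ?_
      rw [ht.envDom hC₁']
      exact Finset.subset_union_right
    obtain ⟨ρ, D', hw', hD'⟩ := hC'.wTrans_left_ren hw hC₂' hk hh (hn.mono_right hA₂)
    refine ⟨D', hw', hsep _ _ (.sep .one k' C₁' (C₂'.ren ρ) C₃ C₄ D D' (hx.ren hR ρ) h₂ ?_ hd₂ ?_
      hA₂ hD hD')⟩
    · rw [Conf.envDom_ren, henv]
    · rw [Conf.used_ren, ht.used hC₁', (hw.invariants hC₂').2.1]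
      exact Set.union_subset_union_left _ hA₁

/-- Since `⊥` has no `term` transition, `C₁` cannot terminate, and neither can the conjunction.
After any move of either component, one component is still below `⊥` and the other below something,
so `utSep` applies again. -/
theorem SepConj.WP_bot_left (hC : SepConj .one k C₁ C₃ C) (hx : Tower x)
    (hsep : utSep x ≤ x) (h₁ : WP x C₁ .bot) (h₂ : WP x C₃ C₄) : WP x C .bot := by
  intro η D ht
  have hbot : ∀ {η D}, Trans C₁ η D → η ≠ .term ∧ x D .bot := fun ht => by
    obtain ⟨D', hw, hR⟩ := h₁ _ _ ht
    obtain ⟨rfl, hη⟩ := hw.of_bot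
    exact ⟨hη, hR⟩
  rcases hC.trans_cases ht with ⟨rfl, hη⟩ | ⟨-, -, h, -⟩ | ⟨C₁', k', h, hk, hD, hn⟩ |
    ⟨-, C₃', k', h, hk, hD, hn⟩
  · exact ⟨.bot, .response _ hη, hx.refl _⟩
  · exact absurd rfl (hbot h).1
  · obtain ⟨hη, hR⟩ := hbot h
    exact ⟨.bot, .response _ hη, hsep _ _ (.botL .one k' C₁' C₃ C₄ D hR (hx.WP_le _ _ h₂) hD)⟩
  · obtain ⟨C₄', hw, hR⟩ := h₂ _ _ h
    refine ⟨.bot, .response _ ?_, hsep _ _ (.botR .one k' C₃' C₄' C₁ D hR (hx.WP_le _ _ h₁) hD)⟩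
    rintro rfl
    have := hD.left_ne_bot
    cases h <;> exact this rfl

theorem SepConj.WP_bot_right (hC : SepConj .one k C₁ C₃ C) (hx : Tower x)
    (hsep : utSep x ≤ x) (h₁ : WP x C₁ C₂) (h₂ : WP x C₃ .bot) : WP x C .bot := by
  intro η D ht
  have hbot : ∀ {η D}, Trans C₃ η D → η ≠ .term ∧ x D .bot := fun ht => by
    obtain ⟨D', hw, hR⟩ := h₂ _ _ ht
    obtain ⟨rfl, hη⟩ := hw.of_bot
    exact ⟨hη, hR⟩
  rcases hC.trans_cases ht with ⟨rfl, hη⟩ | ⟨-, -, -, h, -⟩ | ⟨C₁', k', h, hk, hD, hn⟩ |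
    ⟨-, C₃', k', h, hk, hD, hn⟩
  · exact ⟨.bot, .response _ hη, hx.refl _⟩
  · exact absurd rfl (hbot h).1
  · obtain ⟨C₂', hw, hR⟩ := h₁ _ _ h
    refine ⟨.bot, .response _ ?_, hsep _ _ (.botR .one k' C₁' C₂' C₃ D hR (hx.WP_le _ _ h₂) hD)⟩
    rintro rfl
    have := hD.left_ne_bot
    cases h <;> exact this rfl
  · obtain ⟨hη, hR⟩ := hbot h
    exact ⟨.bot, .response _ hη, hsep _ _ (.botL .one k' C₃' C₁ C₂ D hR (hx.WP_le _ _ h₁) hD)⟩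

theorem SepConj.WP_sep (hC : SepConj .one k C₁ C₃ C) (hx : Tower x) (hsep : utSep x ≤ x)
    (hC' : SepConj .one k C₂ C₄ C') (h₁ : WP x C₁ C₂) (h₂ : WP x C₃ C₄) (hd₁ : C₁.envDom = C₂.envDom)
    (hd₂ : C₃.envDom = C₄.envDom) (hA₁ : C₂.used ⊆ C₁.used) (hA₂ : C₄.used ⊆ C₃.used) :
    WP x C C' := by
  -- In this case `C₃` might move in the left conjunction while `C₂` is running and prevents `C₄`
  -- from answering.
  by_cases hopp : C₁.IsOpp ∧ ¬ C₂.IsOpp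
  · exact WP_of_bot (hC.WP_bot_left hx hsep (WP_bot_of_isOpp hx h₁ hopp.1 hopp.2) h₂) C'
  push Not at hopp
  intro η D ht
  rcases hC.trans_cases ht with ⟨rfl, hη⟩ | ⟨rfl, rfl, -, -, rfl, ho⟩ | hm | ⟨ho, hm⟩
  · exact ⟨.bot, .response _ hη, hx.refl _⟩
  · exact ⟨.bot, (hC'.term (hopp ho)).weak, hx.refl _⟩
  · exact hm.simulated hx hsep h₁ (hx.WP_le _ _ h₂) hd₁ hd₂ hA₁ hA₂ hC'
  -- The second component moves, so `C₁` is an opponent configuration, hence so is `C₂`, and the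
  -- roles may be exchanged on both sides. The idle pair is weakened from `WP x` to `x`.
  · exact hm.simulated hx hsep h₂ (hx.WP_le _ _ h₁) hd₂ hd₁ hA₂ hA₁ (hC'.swap_of_isOpp (hopp ho))

end

/-- Tower induction supplies closure of `x` under `utSep` as a hypothesis while every other closure
property of tower elements remains available; side `two` reduces to side `one` by symmetry. -/
theorem Tower.utSep_le {x : CRel O} (h : Tower x) : utSep x ≤ x := by
  induction h with
  | inf X _ ih => exact le_sInf fun x hx => (utSep_mono (sInf_le hx)).trans (ih x hx)
  | step x hx hsep =>
    intro C C' h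
    cases h with
    | sep i k C₁ C₂ C₃ C₄ _ _ h₁ h₂ hd₁ hd₂ hA₁ hA₂ hC hC' =>
      cases i with
      | one => exact hC.WP_sep hx hsep hC' h₁ h₂ hd₁ hd₂ hA₁ hA₂
      | two => exact hC.swap.WP_sep hx hsep hC'.swap h₂ h₁ hd₂ hd₁ hA₂ hA₁
    | botL i k C₁ C₃ C₄ _ h₁ h₂ hC =>
      cases i with
      | one => exact hC.WP_bot_left hx hsep h₁ h₂
      | two => exact hC.swap.WP_bot_right hx hsep h₂ h₁
    | botR i k C₁ C₂ C₃ _ h₁ h₂ hC =>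
      cases i with
      | one => exact hC.WP_bot_right hx hsep h₁ h₂
      | two => exact hC.swap.WP_bot_left hx hsep h₂ h₁

theorem utSep_le_towerClosure (x : CRel O) : utSep x ≤ towerClosure x :=
  (utSep_mono (le_towerClosure x)).trans (tower_towerClosure x).utSep_le

end SepUpTo

theorem mainTheorem2 (O : SepUpTo.OpSig) :
    Monotone (SepUpTo.utSep (O := O)) ∧
    SepUpTo.IsSoundUpTo (SepUpTo.utSep (O := O)) ∧
    SepUpTo.IsSoundUpTo (fun R : SepUpTo.CRel O => R ⊔ SepUpTo.utSep R) ∧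
    SepUpTo.utSep (O := O) ≤ SepUpTo.companion ∧
    ∀ g : SepUpTo.CRel O → SepUpTo.CRel O, g ≤ SepUpTo.companion →
      SepUpTo.IsSoundUpTo (SepUpTo.omegaIter (SepUpTo.utSep ⊔ g)) := by
  exact ⟨SepUpTo.utSep_mono,
    SepUpTo.isSoundUpTo_of_le_towerClosure SepUpTo.utSep_le_towerClosure,
    SepUpTo.isSoundUpTo_of_le_towerClosure fun x =>
      sup_le (SepUpTo.le_towerClosure x) (SepUpTo.utSep_le_towerClosure x),
    -- The compatible function witnessing membership in the companion is `towerClosure`, not `utSep`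
    -- itself.
    fun x C C' h => ⟨_, SepUpTo.towerClosure_compatible, SepUpTo.utSep_le_towerClosure x C C' h⟩,
    fun g hg => SepUpTo.isSoundUpTo_of_le_towerClosure
      (SepUpTo.omegaIter_le_towerClosure fun x =>
        sup_le (SepUpTo.utSep_le_towerClosure x)
          ((hg x).trans (SepUpTo.companion_le_towerClosure x)))⟩
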